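/- Fix a field $\mathbb{k}$ and an integer $n \ge 2$. Give $\mathbb{R}^n$ the product order and, for $a \in \mathbb{R}^n$ and $r \in \mathbb{R}$, write $a + r = (a_1 + r, \dots, a_n + r)$. An $n$-parameter persistence module (a module, for short) is a functor $M$ from the poset $\mathbb{R}^n$ to the category of finite dimensional $\mathbb{k}$-vector spaces; morphisms of modules are natural transformations, and direct sums are taken pointwise. For $a \in \mathbb{R}^n$ let $\mathsf{P}_a$ be the module that is $\mathbb{k}$ at each $b \ge a$ and $0$ elsewhere, with identities as the structure morphisms that are not forced to be zero. A module is finitely presentable if it is isomorphic to the cokernel of a morphism between two finite direct sums of modules of the form $\mathsf{P}_a$. A module is indecomposable if it is non-zero and not isomorphic to $A \oplus B$ with $A$ and $B$ both non-zero. For $\varepsilon \ge 0$ let $M[\varepsilon]$ be the shifted module, $M[\varepsilon](a) = M(a + \varepsilon)$. Modules $M$ and $N$ are $\varepsilon$-interleaved if there are morphisms $f : M \to N[\varepsilon]$ and $g : N \to M[\varepsilon]$ such that $g[\varepsilon] \circ f : M \to M[2\varepsilon]$ and $f[\varepsilon] \circ g : N \to N[2\varepsilon]$ are given by the structure morphisms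 of $M$ and of $N$, respectively. An $\varepsilon$-matching between $M$ and $N$ consists of decompositions $M \cong \bigoplus_{j \in J} M_j$ and $N \cong \bigoplus_{j \in J} N_j$ indexed by the same set $J$, in which each summand is indecomposable or zero, and such that $M_j$ and $N_j$ are $\varepsilon$-interleaved for every $j \in J$. The interleaving distance $d_I(M,N) \in [0,\infty]$ is the infimum of the $\varepsilon \ge 0$ for which $M$ and $N$ are $\varepsilon$-interleaved, and the bottleneck distance $d_B(M,N) \in [0,\infty]$ is the infimum of the $\varepsilon \ge 0$ for which there is an $\varepsilon$-matching between $M$ and $N$ (with $\inf \emptyset = \infty$). A finitely presentable module $M$ is structurally stable if for every $\varepsilon > 0$ there exists $\delta > 0$ such that every finitely presentable module $N$ with $d_I(M,N) < \delta$ satisfies $d_B(M,N) < \varepsilon$. **Corollary.** Let $n \ge 2$. A finitely presentable $n$-parameter persistence module is structurally stable if and only if it is indecomposable or zero. -/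

import Mathlib

open CategoryTheory Limits
open scoped NNReal ENNReal

universe u

noncomputable section

/-- The product poset `ℝⁿ`, with `a ≤ b` iff `a i ≤ b i` for every coordinate `i`.
It is a separate type so that its category structure is the one coming from the order. -/
def RPoset (n : ℕ) : Type := Fin n → ℝ

namespace RPoset

variable {n : ℕ}

instance : PartialOrder (RPoset n) := inferInstanceAs (PartialOrder (Fin n → ℝ))

/-- The diagonal translate `a + r = (a₁ + r, …, aₙ + r)` for a real number `r`. -/
def translate (a : RPoset n) (r : ℝ) : RPoset n := fun i => a i + r

theorem translate_mono (r : ℝ) : Monotone (fun a : RPoset n => a.translate r) :=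
  fun _ _ h i => add_le_add_left (h i) r

theorem le_translate_translate (a : RPoset n) (r : ℝ≥0) :
    a ≤ (a.translate r).translate r := by
  intro i
  change a i ≤ a i + (r : ℝ) + (r : ℝ)
  have := r.coe_nonneg
  linarith

end RPoset

/-- (Pointwise finite dimensional) `n`-parameter persistence modules over `k`: functors from the
poset `ℝⁿ` to finite dimensional `k`-vector spaces, with natural transformations as morphisms. -/
abbrev PersistenceModule (k : Type u) [Field k] (n : ℕ) :=
  RPoset n ⥤ FGModuleCat.{u} k

namespace PersistenceModule

variable {k : Type u} [Field k] {n : ℕ}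

instance : HasFiniteBiproducts (PersistenceModule k n) := Abelian.hasFiniteBiproducts

section Free

open Classical in
/-- The subspace of `k` that is everything if `a ≤ b` and zero otherwise. -/
def freeSubmodule (k : Type u) [Field k] {n : ℕ} (a b : RPoset n) : Submodule k k :=
  if a ≤ b then ⊤ else ⊥

theorem freeSubmodule_mono (a : RPoset n) {b c : RPoset n} (h : b ≤ c) :
    freeSubmodule k a b ≤ freeSubmodule k a c := by
  unfold freeSubmodule
  by_cases hb : a ≤ b
  · rw [if_pos (hb.trans h)]
    exact le_top
  · rw [if_neg hb]
    exact bot_le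

/-- The free module on one generator in degree `a`: it is `k` at every `b ≥ a` and `0` elsewhere,
with identities `k → k` as the structure morphisms that are not forced to be zero. -/
def free (k : Type u) [Field k] {n : ℕ} (a : RPoset n) : PersistenceModule k n where
  obj b := FGModuleCat.of k (freeSubmodule k a b)
  map f := FGModuleCat.ofHom (Submodule.inclusion (freeSubmodule_mono a (leOfHom f)))

end Free

/-- `M` is isomorphic to the cokernel of a morphism between finite direct sums of free modules on
one generator. -/
def FinitelyPresentable (M : PersistenceModule k n) : Prop :=
  ∃ (p q : ℕ) (a : Fin p → RPoset n) (b : Fin q → RPoset n)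
    (f : (⨁ fun j => free k (b j)) ⟶ (⨁ fun i => free k (a i))),
    Nonempty (M ≅ cokernel f)

/-- The `r`-shift `M[r]`, with `M[r](a) = M(a + r)`. -/
def shift (M : PersistenceModule k n) (r : ℝ) : PersistenceModule k n where
  obj a := M.obj (a.translate r)
  map f := M.map (homOfLE (RPoset.translate_mono r (leOfHom f)))
  map_id a := M.map_id (a.translate r)
  map_comp f g := M.map_comp (homOfLE (RPoset.translate_mono r (leOfHom f)))
    (homOfLE (RPoset.translate_mono r (leOfHom g)))

/-- There is an `ε`-interleaving between `M` and `N`: morphisms `f : M ⟶ N[ε]` and `g : N ⟶ M[ε]`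
such that the composites `M(a) ⟶ N(a + ε) ⟶ M(a + 2ε)` and `N(a) ⟶ M(a + ε) ⟶ N(a + 2ε)` are the
structure morphisms of `M` and of `N`. -/
def Interleaved (ε : ℝ≥0) (M N : PersistenceModule k n) : Prop :=
  ∃ (f : M ⟶ N.shift ε) (g : N ⟶ M.shift ε),
    (∀ a : RPoset n,
      f.app a ≫ g.app (a.translate ε) = M.map (homOfLE (a.le_translate_translate ε))) ∧
    (∀ a : RPoset n,
      g.app a ≫ f.app (a.translate ε) = N.map (homOfLE (a.le_translate_translate ε)))

/-- The interleaving distance (`∞` if there is no interleaving). -/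
def interleavingDist (M N : PersistenceModule k n) : ℝ≥0∞ :=
  ⨅ (ε : ℝ≥0) (_ : Interleaved ε M N), (ε : ℝ≥0∞)

open Classical in
/-- `M` is isomorphic to the direct sum of the family `F`: there are morphisms `ι j : F j ⟶ M`
which at every point `a` induce a bijection `⨁ⱼ F j (a) → M(a)`. -/
def IsDirectSum {J : Type} (M : PersistenceModule k n) (F : J → PersistenceModule k n) : Prop :=
  ∃ ι : ∀ j, F j ⟶ M, ∀ a : RPoset n,
    Function.Bijective
      (DirectSum.toModule k J (M.obj a) (fun j => ((ι j).app a).hom.hom))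

/-- There is an `ε`-matching between `M` and `N`. -/
def Matched (ε : ℝ≥0) (M N : PersistenceModule k n) : Prop :=
  ∃ (J : Type) (F G : J → PersistenceModule k n),
    IsDirectSum M F ∧ IsDirectSum N G ∧
    (∀ j, Indecomposable (F j) ∨ IsZero (F j)) ∧
    (∀ j, Indecomposable (G j) ∨ IsZero (G j)) ∧
    ∀ j, Interleaved ε (F j) (G j)

/-- The bottleneck distance (`∞` if there is no matching). -/
def bottleneckDist (M N : PersistenceModule k n) : ℝ≥0∞ :=
  ⨅ (ε : ℝ≥0) (_ : Matched ε M N), (ε : ℝ≥0∞)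

/-- Structural stability of a (finitely presentable) module `M`: finitely presentable modules that
are close to `M` in the interleaving distance are close to `M` in the bottleneck distance. -/
def StructurallyStable (M : PersistenceModule k n) : Prop :=
  ∀ ε : ℝ≥0, 0 < ε → ∃ δ : ℝ≥0, 0 < δ ∧
    ∀ N : PersistenceModule k n, FinitelyPresentable N →
      interleavingDist M N < δ → bottleneckDist M N < ε

end PersistenceModule

end

/-! ### Pointwise calculus of persistence modules and interleavings -/

noncomputable section
namespace PersistenceModule

variable {k : Type u} [Field k] {n : ℕ}

/-! A finite presentation of `M` involves finitely many degrees, so there is a gap `γ` such that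
shifting any of them by at most `γ` meets no new degree (`exists_gap`). For such shifts `M → M[r]`
induces a bijection `End M ≅ Hom(M, M[r])`: injectivity is `eq_of_tr_eq`, surjectivity is
`exists_factor`. Approximate statements about `M` thereby become exact.

Let `M` be indecomposable and `ε`-interleaved with `N = ⨁ F j`, for small `ε`. Sending `M` to `N`,
projecting to `F j` and returning to `M[2ε]` gives, after removal of the shift, endomorphisms `φ j`
of `M`. They are orthogonal idempotents with sum the identity, so exactly one is `𝟙` and the others
vanish. The corresponding summand of `N` is close to `M`, and the other summands are close to zero
(`matched_of_interleaved`). The zero module is handled directly.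

Conversely, for `n ≥ 2` every finitely presentable `M` is arbitrarily close to an indecomposable `N`
(`exists_gluing`, `Gluing.interleaved`, `Gluing.indecomposable`). To each generator `e i` one adds a
generator `h i`, and to all of them together a short-lived generator `g`, with relations `h i = e i
+ g`. These additions are invisible up to a small shift, but tie all generators to `g`, and an
idempotent is determined by the scalar by which it acts on `g`. If `M` is structurally stable it is
matched to such an `N`; all but one summand of `M` are then close to zero, hence zero by the gap
(`indecomposable_of_matched`). -/

/-- The linear map at `a` underlying a morphism. -/
def ev {M N : PersistenceModule k n} (f : M ⟶ N) (a : RPoset n) : M.obj a →ₗ[k] N.obj a :=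
  (f.app a).hom.hom

/-- The structure map of a module, as a linear map. -/
def tr (M : PersistenceModule k n) {a b : RPoset n} (h : a ≤ b) : M.obj a →ₗ[k] M.obj b :=
  (M.map (homOfLE h)).hom.hom

variable {M N L : PersistenceModule k n}

theorem ext_ev {f g : M ⟶ N} (h : ∀ a x, ev f a x = ev g a x) : f = g :=
  NatTrans.ext (funext fun a => FGModuleCat.hom_ext (LinearMap.ext (h a)))

@[simp] theorem ev_comp (f : M ⟶ N) (g : N ⟶ L) (a : RPoset n) (x : M.obj a) :
    ev (f ≫ g) a x = ev g a (ev f a x) := rfl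

@[simp] theorem ev_id (a : RPoset n) (x : M.obj a) : ev (𝟙 M) a x = x := rfl

@[simp] theorem ev_zero (a : RPoset n) (x : M.obj a) : ev (0 : M ⟶ N) a x = 0 := rfl

@[simp] theorem ev_add (f g : M ⟶ N) (a : RPoset n) (x : M.obj a) :
    ev (f + g) a x = ev f a x + ev g a x := rfl

@[simp] theorem ev_sub (f g : M ⟶ N) (a : RPoset n) (x : M.obj a) :
    ev (f - g) a x = ev f a x - ev g a x := rfl

@[simp] theorem ev_sum {ι : Type*} (s : Finset ι) (f : ι → (M ⟶ N)) (a : RPoset n)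
    (x : M.obj a) : ev (∑ i ∈ s, f i) a x = ∑ i ∈ s, ev (f i) a x := by
  classical
  induction s using Finset.induction_on with
  | empty => simp
  | insert i s hi ih => rw [Finset.sum_insert hi, Finset.sum_insert hi, ev_add, ih]

@[simp] theorem tr_tr {a b c : RPoset n} (h : a ≤ b) (h' : b ≤ c) (x : M.obj a) :
    tr M h' (tr M h x) = tr M (h.trans h') x := by
  have : M.map (homOfLE h) ≫ M.map (homOfLE h') = M.map (homOfLE (h.trans h')) := by
    rw [← M.map_comp]; rfl
  exact congrArg (fun f => f.hom.hom x) this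

theorem ev_tr (f : M ⟶ N) {a b : RPoset n} (h : a ≤ b) (x : M.obj a) :
    ev f b (tr M h x) = tr N h (ev f a x) :=
  congrArg (fun f => f.hom.hom x) (f.naturality (homOfLE h))

/-- A morphism of modules from a natural family of linear maps. -/
def homMk (f : ∀ a, M.obj a →ₗ[k] N.obj a)
    (hf : ∀ {a b : RPoset n} (h : a ≤ b) x, f b (tr M h x) = tr N h (f a x)) : M ⟶ N where
  app a := FGModuleCat.ofHom (f a)
  naturality _ _ g := FGModuleCat.hom_ext (LinearMap.ext fun x => hf (leOfHom g) x)

theorem isIso_of_bijective (f : M ⟶ N) (h : ∀ a, Function.Bijective (ev f a)) : IsIso f := by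
  refine ⟨homMk (fun a => (LinearEquiv.ofBijective (ev f a) (h a)).symm.toLinearMap) ?_, ?_, ?_⟩
  · intro a b hab x
    obtain ⟨y, rfl⟩ := (h a).2 x
    apply (h b).1
    simp only [LinearEquiv.coe_coe]
    rw [← ev_tr]
    exact ((LinearEquiv.ofBijective (ev f b) (h b)).apply_symm_apply _).trans
      (congrArg (fun y => ev f b (tr M hab y))
        ((LinearEquiv.ofBijective (ev f a) (h a)).symm_apply_apply y).symm)
  · refine ext_ev fun a x => ?_
    exact (LinearEquiv.ofBijective (ev f a) (h a)).symm_apply_apply x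
  · refine ext_ev fun a x => ?_
    exact (LinearEquiv.ofBijective (ev f a) (h a)).apply_symm_apply x

theorem isZero_iff : IsZero M ↔ ∀ a (x : M.obj a), x = 0 := by
  rw [IsZero.iff_id_eq_zero]
  constructor
  · intro h a x
    have := congrArg (fun f => ev f a x) h
    simpa using this
  · intro h
    exact ext_ev fun a x => by simp [h a x]

/-- A family of linear maps `M a → N (T a)` is natural along the monotone map `T`. -/
def Natural {T : RPoset n → RPoset n} (hT : Monotone T)
    (f : ∀ a, M.obj a →ₗ[k] N.obj (T a)) : Prop :=
  ∀ ⦃a b : RPoset n⦄ (h : a ≤ b) x, f b (tr M h x) = tr N (hT h) (f a x)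

/-- The interleaving condition in terms of natural families of linear maps. -/
theorem interleaved_iff (ε : ℝ≥0) : Interleaved ε M N ↔
    ∃ (f : ∀ a : RPoset n, M.obj a →ₗ[k] N.obj (a.translate ε))
      (g : ∀ a : RPoset n, N.obj a →ₗ[k] M.obj (a.translate ε)),
      Natural (RPoset.translate_mono ε) f ∧ Natural (RPoset.translate_mono ε) g ∧
      (∀ a x, g (a.translate ε) (f a x) = tr M (a.le_translate_translate ε) x) ∧
      (∀ a x, f (a.translate ε) (g a x) = tr N (a.le_translate_translate ε) x) := by
  constructor
  · rintro ⟨f, g, h1, h2⟩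
    exact ⟨ev f, ev g, fun a b h x => ev_tr f h x, fun a b h x => ev_tr g h x,
      fun a x => congrArg (fun f => f.hom.hom x) (h1 a),
      fun a x => congrArg (fun f => f.hom.hom x) (h2 a)⟩
  · rintro ⟨f, g, hf, hg, h1, h2⟩
    exact ⟨homMk (N := N.shift ε) f (fun h x => hf h x),
      homMk (N := M.shift ε) g (fun h x => hg h x),
      fun a => FGModuleCat.hom_ext (LinearMap.ext (h1 a)),
      fun a => FGModuleCat.hom_ext (LinearMap.ext (h2 a))⟩

@[simp] theorem ev_inv_ev_hom (e : M ≅ N) (a : RPoset n) (x : M.obj a) :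
    ev e.inv a (ev e.hom a x) = x := by
  rw [← ev_comp, e.hom_inv_id, ev_id]

@[simp] theorem ev_hom_ev_inv (e : M ≅ N) (a : RPoset n) (x : N.obj a) :
    ev e.hom a (ev e.inv a x) = x := by
  rw [← ev_comp, e.inv_hom_id, ev_id]

theorem Interleaved.of_iso {ε : ℝ≥0} {M' : PersistenceModule k n} (e : M ≅ M')
    (h : Interleaved ε M' N) : Interleaved ε M N := by
  rw [interleaved_iff] at h ⊢
  obtain ⟨f, g, hf, hg, h1, h2⟩ := h
  refine ⟨fun a => (f a).comp (ev e.hom a), fun a => (ev e.inv _).comp (g a),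
    fun a b h x => ?_, fun a b h x => ?_, fun a x => ?_, fun a x => ?_⟩
  · simp only [LinearMap.comp_apply]
    rw [ev_tr, hf]
  · simp only [LinearMap.comp_apply]
    rw [hg, ev_tr]
  · simp only [LinearMap.comp_apply]
    rw [h1, ev_tr, ev_inv_ev_hom]
  · simp only [LinearMap.comp_apply]
    rw [ev_hom_ev_inv, h2]

theorem Interleaved.mono {ε ε' : ℝ≥0} (hε : ε ≤ ε') (h : Interleaved ε M N) :
    Interleaved ε' M N := by
  rw [interleaved_iff] at h ⊢
  obtain ⟨f, g, hf, hg, h1, h2⟩ := h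
  have le : ∀ a : RPoset n, a.translate ε ≤ a.translate ε' := fun a i =>
    add_le_add_right (NNReal.coe_le_coe.2 hε) (a i)
  refine ⟨fun a => (tr N (le a)).comp (f a), fun a => (tr M (le a)).comp (g a),
    fun a b h x => ?_, fun a b h x => ?_, fun a x => ?_, fun a x => ?_⟩
  · simp only [LinearMap.comp_apply]
    rw [hf, tr_tr, tr_tr]
  · simp only [LinearMap.comp_apply]
    rw [hg, tr_tr, tr_tr]
  · simp only [LinearMap.comp_apply]
    rw [hg, h1, tr_tr, tr_tr]
  · simp only [LinearMap.comp_apply]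
    rw [hf, h2, tr_tr, tr_tr]

end PersistenceModule
end

/-! ### Presentations, lifting of morphisms, and the gap between degrees -/

noncomputable section
namespace PersistenceModule

variable {k : Type u} [Field k] {n : ℕ}

/-- A finite presentation of an `n`-parameter persistence module: graded generators and graded
relations, the latter being linear combinations of generators of smaller degree. -/
structure Presentation (k : Type u) [Field k] (n : ℕ) (α β : Type) where
  /-- the degrees of the generators -/
  gen : α → RPoset n
  /-- the degrees of the relations -/
  rel : β → RPoset n
  /-- the coefficients of the relations -/
  coeff : β → α → k
  gen_le_rel : ∀ j i, coeff j i ≠ 0 → gen i ≤ rel j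

namespace Presentation

variable {α β α' β' : Type}
  (D : Presentation k n α β) (D' : Presentation k n α' β')

/-- The combinations of generators that exist in degree `p`. -/
def G (p : RPoset n) : Submodule k (α → k) where
  carrier := {v | ∀ i, v i ≠ 0 → D.gen i ≤ p}
  zero_mem' := fun i h => absurd rfl h
  add_mem' := by
    intro v w hv hw i h
    by_cases h' : v i = 0
    · exact hw i (by rintro h''; exact h (by simp [h', h'']))
    · exact hv i h'
  smul_mem' := by
    intro c v hv i h
    exact hv i (by rintro h'; exact h (by simp [h']))

/-- The combinations of relations that exist in degree `p`. -/
def R (p : RPoset n) : Submodule k (α → k) :=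
  Submodule.span k (D.coeff '' {j | D.rel j ≤ p})

variable {D D'}

theorem G_mono {p q : RPoset n} (h : p ≤ q) : D.G p ≤ D.G q :=
  fun _ hv i hi => (hv i hi).trans h

theorem R_mono {p q : RPoset n} (h : p ≤ q) : D.R p ≤ D.R q :=
  Submodule.span_mono (Set.image_mono fun _ hj => le_trans hj h)

theorem R_le_iff {p : RPoset n} {W : Submodule k (α → k)} :
    D.R p ≤ W ↔ ∀ j, D.rel j ≤ p → D.coeff j ∈ W := by
  rw [R, Submodule.span_le, Set.image_subset_iff]
  rfl

theorem coeff_mem_R {p : RPoset n} {j : β} (h : D.rel j ≤ p) : D.coeff j ∈ D.R p :=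
  Submodule.subset_span ⟨j, h, rfl⟩

theorem coeff_mem_G {p : RPoset n} {j : β} (h : D.rel j ≤ p) : D.coeff j ∈ D.G p :=
  fun i hi => (D.gen_le_rel j i hi).trans h

theorem R_le_G (p : RPoset n) : D.R p ≤ D.G p :=
  R_le_iff.2 fun _ => coeff_mem_G

theorem single_mem_G [DecidableEq α] {p : RPoset n} {i : α} (h : D.gen i ≤ p) (c : k) :
    (Pi.single i c : α → k) ∈ D.G p := by
  intro i' hi'
  by_cases e : i' = i
  · rwa [e]
  · exact absurd (Pi.single_eq_of_ne (M := fun _ => k) e c) hi'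

variable {T : RPoset n → RPoset n}

/-- The degrees of generators and relations. -/
def deg (D : Presentation k n α β) : α ⊕ β → RPoset n := Sum.elim D.gen D.rel

/-- The map `T` moves no degree of `D` above another one that was not below it. -/
def Stable (D : Presentation k n α β) (T : RPoset n → RPoset n) : Prop :=
  ∀ x y, D.deg y ≤ T (D.deg x) → D.deg y ≤ D.deg x

/-- No new generator appears between a degree of the presentation and its image under `T`;
`Stable.R_le` is the same for relations. -/
theorem Stable.G_le (h : D.Stable T) (x) : D.G (T (D.deg x)) ≤ D.G (D.deg x) :=
  fun _ hv i hi => h x (.inl i) (hv i hi)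

theorem Stable.R_le (h : D.Stable T) (x) : D.R (T (D.deg x)) ≤ D.R (D.deg x) :=
  R_le_iff.2 fun j hj => coeff_mem_R (h x (.inr j) hj)

variable [Fintype α] [Fintype α']

theorem G_le_iff [DecidableEq α] {p : RPoset n} {W : Submodule k (α → k)} :
    D.G p ≤ W ↔ ∀ i, D.gen i ≤ p → (Pi.single i 1 : α → k) ∈ W := by
  constructor
  · exact fun h i hi => h (single_mem_G hi 1)
  · intro h v hv
    rw [pi_eq_sum_univ' v]
    refine Submodule.sum_mem _ fun i _ => ?_
    by_cases hi : v i = 0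
    · rw [hi, zero_smul]
      exact Submodule.zero_mem _
    · refine Submodule.smul_mem _ _ ?_
      have := h i (hv i hi)
      convert this using 1

variable (D)

/-- The presented module. -/
def toModule : PersistenceModule k n where
  obj p := FGModuleCat.of k (D.G p ⧸ (D.R p).submoduleOf (D.G p))
  map {p q} f := FGModuleCat.ofHom (Submodule.mapQ _ _ (Submodule.inclusion (G_mono (leOfHom f)))
    (fun _ hv => R_mono (leOfHom f) hv))
  map_id p := by
    refine FGModuleCat.hom_ext (LinearMap.ext fun x => ?_)
    obtain ⟨v, rfl⟩ := Submodule.mkQ_surjective _ x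
    rfl
  map_comp f g := by
    refine FGModuleCat.hom_ext (LinearMap.ext fun x => ?_)
    obtain ⟨v, rfl⟩ := Submodule.mkQ_surjective _ x
    rfl

/-- The class of a combination of generators. -/
def cls (p : RPoset n) : D.G p →ₗ[k] D.toModule.obj p :=
  ((D.R p).submoduleOf (D.G p)).mkQ

variable {D}

theorem cls_surjective (p : RPoset n) : Function.Surjective (D.cls p) :=
  Submodule.mkQ_surjective _

theorem cls_eq_zero {p : RPoset n} {v : D.G p} : D.cls p v = 0 ↔ (v : α → k) ∈ D.R p :=
  Submodule.Quotient.mk_eq_zero _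

theorem cls_eq_cls {p : RPoset n} {v w : D.G p} :
    D.cls p v = D.cls p w ↔ (v - w : α → k) ∈ D.R p := by
  rw [← sub_eq_zero, ← map_sub, cls_eq_zero]
  rfl

theorem tr_cls {p q : RPoset n} (h : p ≤ q) (v : D.G p) :
    tr D.toModule h (D.cls p v) = D.cls q ⟨v, G_mono h v.2⟩ := rfl

/-- The map of presented modules induced by a map of generators. -/
def lin (L : (α → k) →ₗ[k] (α' → k)) (hG : ∀ p, D.G p ≤ (D'.G (T p)).comap L)
    (hR : ∀ p, D.R p ≤ (D'.R (T p)).comap L) (p : RPoset n) :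
    D.toModule.obj p →ₗ[k] D'.toModule.obj (T p) :=
  Submodule.mapQ _ _ (L.restrict (hG p)) (fun _ hv => hR p hv)

section lin

variable {L : (α → k) →ₗ[k] (α' → k)} {hG : ∀ p, D.G p ≤ (D'.G (T p)).comap L}
  {hR : ∀ p, D.R p ≤ (D'.R (T p)).comap L}

theorem lin_cls (p : RPoset n) (v : D.G p) :
    lin L hG hR p (D.cls p v) = D'.cls (T p) ⟨L v, hG p v.2⟩ := rfl

theorem natural_lin (hT : Monotone T) : Natural hT (lin L hG hR) := by
  intro p q h x
  obtain ⟨v, rfl⟩ := cls_surjective _ x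
  rfl

end lin

open Classical in
/-- Natural maps between presented modules lift to maps of generators. -/
theorem exists_lift (hT : Monotone T) (f : ∀ p, D.toModule.obj p →ₗ[k] D'.toModule.obj (T p))
    (hf : Natural hT f) : ∃ (L : (α → k) →ₗ[k] (α' → k))
      (hG : ∀ p, D.G p ≤ (D'.G (T p)).comap L) (hR : ∀ p, D.R p ≤ (D'.R (T p)).comap L),
      f = lin L hG hR := by
  -- `L` sends each generator to a representative of its image; naturality spreads the agreement
  -- with `f` to all larger degrees.
  choose w hw using fun i : α => cls_surjective _ (f _ (D.cls _ ⟨_, single_mem_G (le_refl _) 1⟩))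
  let L : (α → k) →ₗ[k] (α' → k) := Fintype.linearCombination k fun i => (w i : α' → k)
  have hL : ∀ i, L (Pi.single i 1) = w i := fun i => by
    simp [L, Fintype.linearCombination_apply_single]
  have hG : ∀ p, D.G p ≤ (D'.G (T p)).comap L := fun p => G_le_iff.2 fun i hi => by
    rw [Submodule.mem_comap, hL]
    exact G_mono (hT hi) (w i).2
  have key : ∀ p (v : D.G p), f p (D.cls p v) = D'.cls (T p) ⟨L v, hG p v.2⟩ := by
    intro p
    let A : D.G p →ₗ[k] D'.toModule.obj (T p) := (f p).comp (D.cls p)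
    let B : D.G p →ₗ[k] D'.toModule.obj (T p) := (D'.cls (T p)).comp (L.restrict (hG p))
    have hAB : D.G p ≤ (LinearMap.eqLocus A B).map (D.G p).subtype := by
      refine G_le_iff.2 fun i hi => ?_
      refine ⟨⟨_, single_mem_G hi 1⟩, ?_, rfl⟩
      change f p (tr D.toModule hi (D.cls _ ⟨_, single_mem_G (le_refl _) 1⟩)) =
        D'.cls (T p) ⟨L (Pi.single i 1), _⟩
      rw [hf hi, ← hw, tr_cls]
      congr 2
      exact (hL i).symm
    intro v
    obtain ⟨v', hv', e⟩ := hAB v.2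
    have : v' = v := Subtype.ext e
    rw [this] at hv'
    exact hv'
  have hR : ∀ p, D.R p ≤ (D'.R (T p)).comap L := by
    intro p v hv
    have h1 := key p ⟨v, R_le_G p hv⟩
    rw [cls_eq_zero.2 hv, map_zero] at h1
    exact cls_eq_zero.1 h1.symm
  refine ⟨L, hG, hR, funext fun p => LinearMap.ext fun x => ?_⟩
  obtain ⟨v, rfl⟩ := cls_surjective _ x
  exact key p v

open Classical in
/-- The class of a generator in its own degree. -/
def e (D : Presentation k n α β) (i : α) : D.toModule.obj (D.gen i) :=
  D.cls _ ⟨Pi.single i 1, single_mem_G le_rfl 1⟩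

/-- The generators generate. -/
theorem eq_of_e {X : PersistenceModule k n} {f g : D.toModule ⟶ X}
    (h : ∀ i, ev f _ (D.e i) = ev g _ (D.e i)) : f = g := by
  classical
  refine ext_ev fun p x => ?_
  obtain ⟨v, rfl⟩ := cls_surjective _ x
  have : D.G p ≤ (LinearMap.eqLocus ((ev f p).comp (D.cls p)) ((ev g p).comp (D.cls p))).map
      (D.G p).subtype := by
    refine G_le_iff.2 fun i hi => ⟨⟨_, single_mem_G hi 1⟩, ?_, rfl⟩
    change ev f p (tr D.toModule hi (D.e i)) = ev g p (tr D.toModule hi (D.e i))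
    rw [ev_tr, ev_tr, h]
  obtain ⟨v', hv', e⟩ := this v.2
  have : v' = v := Subtype.ext e
  rw [this] at hv'
  exact hv'

/-- Each of the finitely many false inequalities between degrees fails in some coordinate by a
positive margin; `γ` is chosen below all these margins. -/
theorem exists_gap [Finite β] (D : Presentation k n α β) :
    ∃ γ : ℝ≥0, 0 < γ ∧ ∀ r : ℝ, r ≤ γ → D.Stable fun a => a.translate r := by
  have : ∀ᶠ γ : ℝ in nhdsWithin 0 (Set.Ioi 0), ∀ x y, D.deg y ≤ (D.deg x).translate γ →
      D.deg y ≤ D.deg x := by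
    rw [Filter.eventually_all]
    intro x
    rw [Filter.eventually_all]
    intro y
    by_cases h : D.deg y ≤ D.deg x
    · exact Filter.Eventually.of_forall fun _ _ => h
    · obtain ⟨c, hc⟩ : ∃ c, D.deg x c < D.deg y c := by
        by_contra! h'
        exact h h'
      filter_upwards [Ioo_mem_nhdsGT (sub_pos.2 hc)] with γ hγ h'
      have h1 : D.deg y c ≤ D.deg x c + γ := h' c
      have := hγ.2
      linarith
  obtain ⟨γ, hγ, h0⟩ := (this.and self_mem_nhdsWithin).exists
  refine ⟨⟨γ, le_of_lt h0⟩, h0, fun r hr x y h => hγ x y (h.trans fun c => ?_)⟩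
  exact add_le_add_right hr (D.deg x c)

/-- In the degree of a generator the relation space does not grow under `T`, so the structure map is
injective there, and morphisms are determined by their values on generators. -/
theorem eq_of_tr_eq (hT : ∀ a, a ≤ T a) (hD : D.Stable T) {f g : D.toModule ⟶ D.toModule}
    (h : ∀ a x, tr D.toModule (hT a) (ev f a x) = tr D.toModule (hT a) (ev g a x)) : f = g := by
  refine eq_of_e fun i => ?_
  have := h _ (D.e i)
  rw [← sub_eq_zero, ← map_sub] at this
  obtain ⟨v, hv⟩ := cls_surjective _ (ev f _ (D.e i) - ev g _ (D.e i))
  rw [← sub_eq_zero, ← hv, cls_eq_zero]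
  rw [← hv, tr_cls, cls_eq_zero] at this
  exact hD.R_le (.inl i) this

/-- A lift `L` of `f` to generators respects `G` and `R` up to `T`. In the degrees of generators and
relations `T` changes neither subspace, so the same `L` already induces an unshifted endomorphism.
-/
theorem exists_factor (hT : ∀ a, a ≤ T a) (hT' : Monotone T) (hD : D.Stable T)
    (f : ∀ p, D.toModule.obj p →ₗ[k] D.toModule.obj (T p)) (hf : Natural hT' f) :
    ∃ g : D.toModule ⟶ D.toModule, ∀ a x, f a x = tr D.toModule (hT a) (ev g a x) := by
  classical
  obtain ⟨L, hG, hR, rfl⟩ := exists_lift hT' f hf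
  have hG' : ∀ p, D.G p ≤ (D.G ((fun a => a) p)).comap L := fun p => G_le_iff.2 fun i hi =>
    G_mono hi (hD.G_le (.inl i) (hG _ (single_mem_G le_rfl 1)))
  have hR' : ∀ p, D.R p ≤ (D.R ((fun a => a) p)).comap L := fun p => R_le_iff.2 fun j hj =>
    R_mono hj (hD.R_le (.inr j) (hR _ (coeff_mem_R le_rfl)))
  refine ⟨homMk (lin L hG' hR') (fun h x => natural_lin (monotone_id) h x), fun a x => ?_⟩
  obtain ⟨v, rfl⟩ := cls_surjective _ x
  rfl

/-- A sufficient condition for two presented modules to be interleaved. -/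
theorem interleaved (ε : ℝ≥0) (A : (α → k) →ₗ[k] (α' → k)) (B : (α' → k) →ₗ[k] (α → k))
    (hAG : ∀ p, D.G p ≤ (D'.G (p.translate ε)).comap A)
    (hAR : ∀ p, D.R p ≤ (D'.R (p.translate ε)).comap A)
    (hBG : ∀ p, D'.G p ≤ (D.G (p.translate ε)).comap B)
    (hBR : ∀ p, D'.R p ≤ (D.R (p.translate ε)).comap B)
    (hBA : ∀ p, ∀ v ∈ D.G p, B (A v) - v ∈ D.R ((p.translate ε).translate ε))
    (hAB : ∀ p, ∀ v ∈ D'.G p, A (B v) - v ∈ D'.R ((p.translate ε).translate ε)) :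
    Interleaved ε D.toModule D'.toModule := by
  rw [interleaved_iff]
  refine ⟨lin A hAG hAR, lin B hBG hBR, natural_lin _, natural_lin _, fun a x => ?_,
    fun a x => ?_⟩
  · obtain ⟨v, rfl⟩ := cls_surjective _ x
    rw [lin_cls, lin_cls, tr_cls, cls_eq_cls]
    exact hBA a v v.2
  · obtain ⟨v, rfl⟩ := cls_surjective _ x
    rw [lin_cls, lin_cls, tr_cls, cls_eq_cls]
    exact hAB a v v.2

end Presentation
end PersistenceModule
end

/-! ### Idempotents and decompositions into indecomposables -/

noncomputable section

section Idempotents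

variable {C : Type*} [Category C] [Abelian C] {X : C}

/-- Idempotents split in an abelian category, and splittings of `e` and `𝟙 X - e` exhibit `X` as a
biproduct. -/
theorem CategoryTheory.Indecomposable.eq_zero_or_id (hX : Indecomposable X) {e : X ⟶ X}
    (he : e ≫ e = e) :
    e = 0 ∨ e = 𝟙 X := by
  have he' : (𝟙 X - e) ≫ (𝟙 X - e) = 𝟙 X - e := by
    simp [he]
  obtain ⟨Y, i, r, hi, hr⟩ := IsIdempotentComplete.idempotents_split X e he
  obtain ⟨Z, i', r', hi', hr'⟩ := IsIdempotentComplete.idempotents_split X (𝟙 X - e) he'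
  have h1 : i ≫ r' = 0 := by
    have : i ≫ r' = (i ≫ r) ≫ (i ≫ r') ≫ (i' ≫ r') := by simp [hi, hi']
    rw [this]
    have : (i ≫ r) ≫ (i ≫ r') ≫ (i' ≫ r') = i ≫ (r ≫ i) ≫ (r' ≫ i') ≫ r' := by simp
    rw [this, hr, hr']
    simp [reassoc_of% he]
  have h2 : i' ≫ r = 0 := by
    have : i' ≫ r = (i' ≫ r') ≫ (i' ≫ r) ≫ (i ≫ r) := by simp [hi, hi']
    rw [this]
    have : (i' ≫ r') ≫ (i' ≫ r) ≫ (i ≫ r) = i' ≫ (r' ≫ i') ≫ (r ≫ i) ≫ r := by simp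
    rw [this, hr, hr']
    simp [reassoc_of% he]
  have iso : X ≅ Y ⊞ Z :=
    { hom := biprod.lift r r'
      inv := biprod.desc i i'
      hom_inv_id := by simp [biprod.lift_desc, hr, hr']
      inv_hom_id := by
        ext <;> simp [hi, hi', h1, h2] }
  rcases hX.2 Y Z iso with h | h
  · left
    rw [← hr, h.eq_of_src i 0, comp_zero]
  · right
    have : 𝟙 X - e = 0 := by rw [← hr', h.eq_of_src i' 0, comp_zero]
    exact (sub_eq_zero.1 this).symm

theorem indecomposable_of_forall_idempotent (hX : ¬ IsZero X)
    (h : ∀ e : X ⟶ X, e ≫ e = e → e = 0 ∨ e = 𝟙 X) : Indecomposable X := by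
  refine ⟨hX, fun Y Z i => ?_⟩
  rcases h (i.hom ≫ biprod.fst ≫ biprod.inl ≫ i.inv) (by simp) with h | h
  · left
    have : (biprod.inl ≫ i.inv) ≫ (i.hom ≫ biprod.fst ≫ biprod.inl ≫ i.inv) ≫
      i.hom ≫ biprod.fst = 𝟙 Y := by simp
    rw [IsZero.iff_id_eq_zero, ← this, h]
    simp
  · right
    have : (biprod.inr ≫ i.inv) ≫ (i.hom ≫ biprod.fst ≫ biprod.inl ≫ i.inv) ≫
      i.hom ≫ biprod.snd = 0 := by simp
    rw [h] at this
    rw [IsZero.iff_id_eq_zero, ← this]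
    simp

theorem CategoryTheory.Indecomposable.of_iso {Y : C} (hX : Indecomposable X) (i : X ≅ Y) :
    Indecomposable Y :=
  ⟨fun h => hX.1 (h.of_iso i), fun A B j => hX.2 A B (i ≪≫ j)⟩

end Idempotents

namespace PersistenceModule

variable {k : Type u} [Field k] {n : ℕ} {M N : PersistenceModule k n}

/-- A finite decomposition of `M` as the direct sum of the modules `F j`. -/
structure Decomp (M : PersistenceModule k n) {J : Type} [Fintype J]
    (F : J → PersistenceModule k n) where
  /-- the inclusions -/
  ι : ∀ j, F j ⟶ M
  /-- the projections -/
  π : ∀ j, M ⟶ F j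
  ι_π : ∀ j, ι j ≫ π j = 𝟙 (F j)
  ι_π_ne : ∀ i j, i ≠ j → ι i ≫ π j = 0
  total : ∑ j, π j ≫ ι j = 𝟙 M

theorem Decomp.isDirectSum {J : Type} [Fintype J] {F : J → PersistenceModule k n}
    (d : Decomp M F) : IsDirectSum M F := by
  classical
  refine ⟨d.ι, fun a => ?_⟩
  have key : ∀ j (y : DirectSum J fun j => (F j).obj a),
      ev (d.π j) a (DirectSum.toModule k J (M.obj a) (fun j => ev (d.ι j) a) y) = y j := by
    intro j y
    induction y using DirectSum.induction_on with
    | zero => simp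
    | of i x =>
      change ev (d.π j) a (DirectSum.toModule k J (M.obj a) (fun j => ev (d.ι j) a)
        (DirectSum.lof k J _ i x)) = _
      rw [DirectSum.toModule_lof, ← ev_comp]
      by_cases hij : i = j
      · subst hij
        rw [d.ι_π, ev_id, DirectSum.of_eq_same]
      · rw [d.ι_π_ne i j hij, ev_zero, DirectSum.of_eq_of_ne _ _ _ (Ne.symm hij)]
    | add x y hx hy => rw [map_add, map_add, hx, hy, DirectSum.add_apply]
  constructor
  · intro y y' h
    ext j
    rw [← key j y, ← key j y']
    exact congrArg _ h
  · intro x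
    refine ⟨∑ j, DirectSum.lof k J (fun j => (F j).obj a) j (ev (d.π j) a x), ?_⟩
    rw [map_sum]
    have h := congrArg (fun f => ev f a x) d.total
    simp only [ev_sum, ev_comp, ev_id] at h
    refine Eq.trans (Finset.sum_congr rfl fun j _ => ?_) h
    exact DirectSum.toModule_lof k j _

/-- The index type may be infinite, so the identity is not available as a finite sum `∑ π j ≫ ι j`;
joint epimorphy of the inclusions takes its place. -/
theorem IsDirectSum.exists_proj {J : Type} {F : J → PersistenceModule k n}
    (h : IsDirectSum M F) : ∃ (ι : ∀ j, F j ⟶ M) (π : ∀ j, M ⟶ F j),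
      (∀ j, ι j ≫ π j = 𝟙 (F j)) ∧ (∀ i j, i ≠ j → ι i ≫ π j = 0) ∧
      ∀ (X : PersistenceModule k n) (f g : M ⟶ X), (∀ j, ι j ≫ f = ι j ≫ g) → f = g := by
  classical
  obtain ⟨ι, hι⟩ := h
  let E : ∀ a, (DirectSum J fun j => (F j).obj a) ≃ₗ[k] M.obj a := fun a =>
    LinearEquiv.ofBijective (DirectSum.toModule k J (M.obj a) (fun j => ev (ι j) a))
      (by convert hι a; rfl)
  have hE : ∀ a j x, E a (DirectSum.lof k J _ j x) = ev (ι j) a x := fun a j x =>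
    DirectSum.toModule_lof (ι := J) k (M := fun j => (F j).obj a) (N := M.obj a)
      (φ := fun j => ev (ι j) a) j x
  have hE' : ∀ a j x, (E a).symm (ev (ι j) a x) = DirectSum.lof k J _ j x := fun a j x => by
    rw [← hE, LinearEquiv.symm_apply_apply]
  have ind : ∀ {a : RPoset n} {V : Type u} [AddCommGroup V] [Module k V]
      {A B : M.obj a →ₗ[k] V}, (∀ j x, A (ev (ι j) a x) = B (ev (ι j) a x)) → ∀ x, A x = B x := by
    intro a V _ _ A B hAB x
    have : A.comp (E a).toLinearMap = B.comp (E a).toLinearMap := by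
      refine DirectSum.linearMap_ext k fun j => LinearMap.ext fun x => ?_
      simp only [LinearMap.comp_apply, LinearEquiv.coe_coe, hE]
      exact hAB j x
    have h' := congrArg (fun f => f ((E a).symm x)) this
    simpa using h'
  have nat : ∀ j {a b : RPoset n} (h : a ≤ b) (x : M.obj a),
      DirectSum.component k J (fun j => (F j).obj b) j ((E b).symm (tr M h x)) =
      tr (F j) h (DirectSum.component k J (fun j => (F j).obj a) j ((E a).symm x)) := by
    intro j a b hab
    refine ind (A := (DirectSum.component k J (fun j => (F j).obj b) j).comp
      ((E b).symm.toLinearMap.comp (tr M hab))) (B := (tr (F j) hab).comp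
      ((DirectSum.component k J (fun j => (F j).obj a) j).comp (E a).symm.toLinearMap)) ?_
    intro i x
    simp only [LinearMap.comp_apply, LinearEquiv.coe_coe]
    rw [← ev_tr, hE', hE']
    by_cases hij : i = j
    · subst hij
      rw [DirectSum.component.lof_self, DirectSum.component.lof_self]
    · rw [DirectSum.component.of, DirectSum.component.of, dif_neg hij, dif_neg hij, map_zero]
  let π : ∀ j, M ⟶ F j := fun j =>
    homMk (fun a => (DirectSum.component k J (fun j => (F j).obj a) j).comp
      (E a).symm.toLinearMap) (fun h x => nat j h x)
  have hπ : ∀ j a x, ev (π j) a x =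
    DirectSum.component k J (fun j => (F j).obj a) j ((E a).symm x) := fun j a x => rfl
  refine ⟨ι, π, fun j => ext_ev fun a x => ?_, fun i j hij => ext_ev fun a x => ?_, ?_⟩
  · rw [ev_comp, hπ, hE', DirectSum.component.lof_self, ev_id]
  · rw [ev_comp, hπ, hE', DirectSum.component.of, dif_neg hij, ev_zero]
  · intro X f g hfg
    refine ext_ev fun a => ind fun j x => ?_
    exact congrArg (fun f => ev f a x) (hfg j)

/-- The module `X` is generated in the degrees `s i`. -/
def GeneratedAt {I : Type} (s : I → RPoset n) (X : PersistenceModule k n) : Prop :=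
  ∀ (Y : PersistenceModule k n) (f g : X ⟶ Y), (∀ i x, ev f (s i) x = ev g (s i) x) → f = g

theorem GeneratedAt.of_retract {I : Type} {s : I → RPoset n} {X Y : PersistenceModule k n}
    (h : GeneratedAt s X) (i : Y ⟶ X) (r : X ⟶ Y) (hir : i ≫ r = 𝟙 Y) : GeneratedAt s Y := by
  intro Z f g hfg
  have : r ≫ f = r ≫ g := h _ _ _ fun i x => by rw [ev_comp, ev_comp, hfg]
  rw [← Category.id_comp f, ← Category.id_comp g, ← hir, Category.assoc, Category.assoc, this]

theorem Presentation.generatedAt {α β : Type} [Fintype α] (D : Presentation k n α β) :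
    GeneratedAt D.gen D.toModule :=
  fun _ _ _ h => Presentation.eq_of_e fun i => h i _

/-- Induction on the total dimension at the generating degrees. Both factors of a splitting are
again generated in the degrees `s i`, being retracts, so a nonzero factor has positive total
dimension and its complement has a strictly smaller one. -/
theorem GeneratedAt.exists_decomp {I : Type} [Fintype I] {s : I → RPoset n} (m : ℕ) :
    ∀ X : PersistenceModule k n, GeneratedAt s X →
      ∑ i, Module.finrank k (X.obj (s i)) ≤ m →
      ∃ (J : Type) (_ : Fintype J) (F : J → PersistenceModule k n),
        Nonempty (Decomp X F) ∧ ∀ j, Indecomposable (F j) := by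
  induction m with
  | zero =>
    intro X hX hm
    have h0 : 𝟙 X = 0 := hX _ _ _ fun i x => by
      have := (Finset.sum_eq_zero_iff.1 (Nat.le_zero.1 hm)) i (Finset.mem_univ _)
      have := Module.finrank_zero_iff.1 this
      exact Subsingleton.elim _ _
    exact ⟨Empty, inferInstance, Empty.elim, ⟨⟨fun j => j.elim, fun j => j.elim,
      fun j => j.elim, fun j => j.elim, by simp [h0]⟩⟩, fun j => j.elim⟩
  | succ m ih =>
    intro X hX hm
    by_cases hz : IsZero X
    · exact ⟨Empty, inferInstance, Empty.elim, ⟨⟨fun j => j.elim, fun j => j.elim,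
        fun j => j.elim, fun j => j.elim, by simp [hz.eq_of_src (𝟙 X) 0]⟩⟩, fun j => j.elim⟩
    by_cases hi : Indecomposable X
    · exact ⟨Unit, inferInstance, fun _ => X, ⟨⟨fun _ => 𝟙 X, fun _ => 𝟙 X, by simp,
        fun i j h => absurd rfl h, by simp⟩⟩, fun _ => hi⟩
    obtain ⟨Y, Z, i, hY, hZ⟩ : ∃ Y Z, ∃ _ : X ≅ Y ⊞ Z, ¬ IsZero Y ∧ ¬ IsZero Z := by
      by_contra! h
      exact hi ⟨hz, fun Y Z i => or_iff_not_imp_left.2 (h Y Z i)⟩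
    have gY : GeneratedAt s Y := hX.of_retract (biprod.inl ≫ i.inv) (i.hom ≫ biprod.fst)
      (by simp)
    have gZ : GeneratedAt s Z := hX.of_retract (biprod.inr ≫ i.inv) (i.hom ≫ biprod.snd)
      (by simp)
    have rank : ∀ a, Module.finrank k (Y.obj a) + Module.finrank k (Z.obj a) ≤
        Module.finrank k (X.obj a) := by
      intro a
      rw [← Module.finrank_prod]
      refine LinearMap.finrank_le_finrank_of_injective
        (f := (ev (biprod.inl ≫ i.inv) a).coprod (ev (biprod.inr ≫ i.inv) a)) ?_
      have h1 : ∀ y z, ev (i.hom ≫ biprod.fst) a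
          ((ev (biprod.inl ≫ i.inv) a).coprod (ev (biprod.inr ≫ i.inv) a) (y, z)) = y := by
        intro y z
        rw [LinearMap.coprod_apply, map_add, ← ev_comp, ← ev_comp]
        simp only [Category.assoc, Iso.inv_hom_id_assoc, biprod.inl_fst, biprod.inr_fst]
        simp
      have h2 : ∀ y z, ev (i.hom ≫ biprod.snd) a
          ((ev (biprod.inl ≫ i.inv) a).coprod (ev (biprod.inr ≫ i.inv) a) (y, z)) = z := by
        intro y z
        rw [LinearMap.coprod_apply, map_add, ← ev_comp, ← ev_comp]
        simp only [Category.assoc, Iso.inv_hom_id_assoc, biprod.inl_snd, biprod.inr_snd]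
        simp
      rintro ⟨y, z⟩ ⟨y', z'⟩ h
      exact Prod.ext ((h1 y z).symm.trans ((congrArg _ h).trans (h1 y' z')))
        ((h2 y z).symm.trans ((congrArg _ h).trans (h2 y' z')))
    have pos : ∀ W : PersistenceModule k n, GeneratedAt s W → ¬ IsZero W →
        0 < ∑ i, Module.finrank k (W.obj (s i)) := by
      intro W hW h
      by_contra! h'
      refine h ((IsZero.iff_id_eq_zero _).2 (hW _ _ _ fun i x => ?_))
      have := (Finset.sum_eq_zero_iff.1 (Nat.le_zero.1 h')) i (Finset.mem_univ _)
      have := Module.finrank_zero_iff.1 this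
      exact Subsingleton.elim _ _
    have hsum := Finset.sum_le_sum fun i (_ : i ∈ Finset.univ) => rank (s i)
    rw [Finset.sum_add_distrib] at hsum
    have pY := pos Y gY hY
    have pZ := pos Z gZ hZ
    obtain ⟨J, _, F, ⟨d⟩, hF⟩ := ih Y gY (by omega)
    obtain ⟨J', _, F', ⟨d'⟩, hF'⟩ := ih Z gZ (by omega)
    refine ⟨J ⊕ J', inferInstance, Sum.elim F F', ⟨⟨fun j => match j with
        | .inl j => d.ι j ≫ biprod.inl ≫ i.inv
        | .inr j => d'.ι j ≫ biprod.inr ≫ i.inv, fun j => match j with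
        | .inl j => i.hom ≫ biprod.fst ≫ d.π j
        | .inr j => i.hom ≫ biprod.snd ≫ d'.π j, ?_, ?_, ?_⟩⟩, ?_⟩
    · rintro (j | j)
      · simpa using d.ι_π j
      · simpa using d'.ι_π j
    · rintro (j | j) (j' | j') h
      · have h0 : (d.ι j ≫ biprod.inl ≫ i.inv) ≫ i.hom ≫ biprod.fst ≫ d.π j' = 0 := by
          simpa using d.ι_π_ne j j' (fun e => h (by rw [e]))
        exact h0
      · have h0 : (d.ι j ≫ biprod.inl ≫ i.inv) ≫ i.hom ≫ biprod.snd ≫ d'.π j' = 0 := by simp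
        exact h0
      · have h0 : (d'.ι j ≫ biprod.inr ≫ i.inv) ≫ i.hom ≫ biprod.fst ≫ d.π j' = 0 := by simp
        exact h0
      · have h0 : (d'.ι j ≫ biprod.inr ≫ i.inv) ≫ i.hom ≫ biprod.snd ≫ d'.π j' = 0 := by
          simpa using d'.ι_π_ne j j' (fun e => h (by rw [e]))
        exact h0
    · rw [Fintype.sum_sum_type]
      have e1 : ∑ j, (i.hom ≫ biprod.fst ≫ d.π j) ≫ d.ι j ≫ biprod.inl ≫ i.inv =
          i.hom ≫ (biprod.fst ≫ biprod.inl) ≫ i.inv := by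
        have := d.total
        calc _ = (i.hom ≫ biprod.fst) ≫ (∑ j, d.π j ≫ d.ι j) ≫ biprod.inl ≫ i.inv := by
              rw [Preadditive.sum_comp, Preadditive.comp_sum]
              simp
          _ = _ := by rw [this]; simp
      have e2 : ∑ j, (i.hom ≫ biprod.snd ≫ d'.π j) ≫ d'.ι j ≫ biprod.inr ≫ i.inv =
          i.hom ≫ (biprod.snd ≫ biprod.inr) ≫ i.inv := by
        have := d'.total
        calc _ = (i.hom ≫ biprod.snd) ≫ (∑ j, d'.π j ≫ d'.ι j) ≫ biprod.inr ≫ i.inv := by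
              rw [Preadditive.sum_comp, Preadditive.comp_sum]
              simp
          _ = _ := by rw [this]; simp
      change ∑ j, (i.hom ≫ biprod.fst ≫ d.π j) ≫ d.ι j ≫ biprod.inl ≫ i.inv +
        ∑ j, (i.hom ≫ biprod.snd ≫ d'.π j) ≫ d'.ι j ≫ biprod.inr ≫ i.inv = 𝟙 X
      rw [e1, e2, ← Preadditive.comp_add, ← Preadditive.add_comp, biprod.total]
      simp
    · rintro (j | j)
      · exact hF j
      · exact hF' j

end PersistenceModule
end

/-! ### Matchings of modules close to an indecomposable one -/

noncomputable section
namespace PersistenceModule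

variable {k : Type u} [Field k] {n : ℕ} {M N : PersistenceModule k n}

theorem Interleaved.symm {ε : ℝ≥0} (h : Interleaved ε M N) : Interleaved ε N M := by
  obtain ⟨f, g, h1, h2⟩ := h
  exact ⟨g, f, h2, h1⟩

theorem interleaved_of_isZero {ε : ℝ≥0} {Z X : PersistenceModule k n} (hZ : IsZero Z)
    (hX : ∀ a x, tr X (RPoset.le_translate_translate a ε) x = 0) : Interleaved ε Z X := by
  rw [interleaved_iff]
  rw [isZero_iff] at hZ
  refine ⟨0, 0, fun a b h x => ?_, fun a b h x => ?_, fun a x => ?_, fun a x => ?_⟩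
  · simp
  · simp
  · rw [hZ a x, map_zero, map_zero, map_zero]
  · rw [hX]
    simp

theorem Interleaved.tr_eq_zero {ε : ℝ≥0} {Z X : PersistenceModule k n} (hZ : IsZero Z)
    (h : Interleaved ε X Z) (a : RPoset n) (x : X.obj a) :
    tr X (RPoset.le_translate_translate a ε) x = 0 := by
  obtain ⟨f, g, -, -, h1, -⟩ := (interleaved_iff ε).1 h
  rw [← h1, isZero_iff.1 hZ _ (f a x), map_zero]

theorem Matched.of_iso {ε : ℝ≥0} {M' : PersistenceModule k n} (e : M' ≅ M)
    (h : Matched ε M N) : Matched ε M' N := by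
  obtain ⟨J, F, G, hF, hG, h'⟩ := h
  refine ⟨J, F, G, ?_, hG, h'⟩
  obtain ⟨ι, hι⟩ := hF
  refine ⟨fun j => ι j ≫ e.inv, fun a => ?_⟩
  have hb : Function.Bijective (ev e.inv a) :=
    ⟨fun x y h => by rw [← ev_hom_ev_inv e a x, h, ev_hom_ev_inv],
      fun y => ⟨ev e.hom a y, ev_inv_ev_hom e a y⟩⟩
  convert hb.comp (hι a) using 1
  classical
  funext x
  induction x using DirectSum.induction_on with
  | zero => simp
  | of i x =>
    refine (DirectSum.toModule_lof (ι := J) k (M := fun j => (F j).obj a) (N := M'.obj a)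
      (φ := fun j => ev (ι j ≫ e.inv) a) i x).trans ?_
    exact (congrArg (ev e.inv a) (DirectSum.toModule_lof (ι := J) k (M := fun j => (F j).obj a)
      (N := M.obj a) (φ := fun j => ev (ι j) a) i x)).symm
  | add x y hx hy =>
    rw [map_add, hx, hy]
    simp only [Function.comp_apply, map_add]

open Classical in
/-- The decomposition of `M` with only one non-zero summand. -/
def Decomp.ofIso {J : Type} [Fintype J] {F : J → PersistenceModule k n} (j₀ : J)
    (i : F j₀ ≅ M) (hz : ∀ j, j ≠ j₀ → IsZero (F j)) : Decomp M F where
  ι j := if h : j = j₀ then eqToHom (congrArg F h) ≫ i.hom else 0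
  π j := if h : j = j₀ then i.inv ≫ eqToHom (congrArg F h.symm) else 0
  ι_π j := by
    by_cases h : j = j₀
    · subst h
      simp
    · exact (hz j h).eq_of_src _ _
  ι_π_ne j j' h := by
    by_cases hj : j = j₀
    · exact (hz j' fun e => h (hj.trans e.symm)).eq_of_tgt _ _
    · exact (hz j hj).eq_of_src _ _
  total := by
    rw [Finset.sum_eq_single j₀]
    · simp
    · intro j _ hj
      simp [hj]
    · simp

theorem le_double (a : RPoset n) (ε : ℝ≥0) :
    (((a.translate ε).translate ε).translate ε).translate ε ≤
      (a.translate (2 * ε : ℝ≥0)).translate (2 * ε : ℝ≥0) := by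
  intro i
  change a i + (ε : ℝ) + (ε : ℝ) + (ε : ℝ) + (ε : ℝ) ≤ a i + ((2 * ε : ℝ≥0) : ℝ) +
    ((2 * ε : ℝ≥0) : ℝ)
  push_cast
  linarith

theorem double_mono (ε : ℝ) :
    Monotone fun a : RPoset n => (a.translate ε).translate ε :=
  fun _ _ h => RPoset.translate_mono ε (RPoset.translate_mono ε h)

open Classical in
/-- Structural stability of indecomposables: a decomposition of a module close to `M` has one
summand close to `M` while all the other ones are close to zero. -/
theorem matched_of_interleaved {α β : Type} [Fintype α]
    (D : Presentation k n α β) (hM : Indecomposable D.toModule) {ε : ℝ≥0}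
    (hε : ∀ r : ℝ, r ≤ 4 * ε → D.Stable fun a => a.translate r)
    (h : Interleaved ε D.toModule N) {J : Type} [Fintype J] {F : J → PersistenceModule k n}
    (d : Decomp N F) (hF : ∀ j, Indecomposable (F j)) : Matched (2 * ε) D.toModule N := by
  obtain ⟨f, g, hf, hg, hgf, hfg⟩ := (interleaved_iff ε).1 h
  have hε0 : (0 : ℝ) ≤ ε := ε.2
  have s2 : D.Stable fun a => (a.translate ε).translate ε := by
    intro x y hxy
    refine hε (2 * ε) (by linarith) x y fun c => (hxy c).trans (le_of_eq ?_)
    change D.deg x c + (ε : ℝ) + (ε : ℝ) = D.deg x c + 2 * (ε : ℝ)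
    ring
  have s4 : D.Stable fun a => (((a.translate ε).translate ε).translate ε).translate ε := by
    intro x y hxy
    refine hε (4 * ε) le_rfl x y fun c => (hxy c).trans (le_of_eq ?_)
    change D.deg x c + (ε : ℝ) + (ε : ℝ) + (ε : ℝ) + (ε : ℝ) = D.deg x c + 4 * (ε : ℝ)
    ring
  let χ : ∀ (j : J) (a : RPoset n),
      D.toModule.obj a →ₗ[k] D.toModule.obj ((a.translate ε).translate ε) := fun j a =>
    (g (a.translate ε)).comp ((ev (d.π j ≫ d.ι j) (a.translate ε)).comp (f a))
  have hχ : ∀ j a x, χ j a x = g (a.translate ε) (ev (d.π j ≫ d.ι j) (a.translate ε) (f a x)) :=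
    fun j a x => rfl
  have nχ : ∀ j, Natural (double_mono (n := n) ε) (χ j) := by
    intro j a b hab x
    rw [hχ, hf, ev_tr, hg, hχ]
  choose φ hφ using fun j =>
    Presentation.exists_factor (fun a => RPoset.le_translate_translate a ε) _ s2 (χ j) (nχ j)
  -- After a shift by `4ε`, `φ j ≫ φ i` is the product of the two projections of `N`, conjugated by
  -- `f` and `g`: the inner passage from `N` to `M` and back is a structure map of `N`, which can be
  -- moved to the end.
  have hφφ : ∀ i j a x, tr D.toModule (RPoset.le_translate_translate _ ε)
      (tr D.toModule (RPoset.le_translate_translate a ε) (ev (φ j ≫ φ i) a x)) =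
      tr D.toModule (RPoset.le_translate_translate _ ε)
        (g (a.translate ε) (ev ((d.π j ≫ d.ι j) ≫ d.π i ≫ d.ι i) (a.translate ε) (f a x))) := by
    intro i j a x
    rw [ev_comp, ← hφ, ← nχ, ← hφ, hχ, hχ, hfg, ev_tr, hg, ev_comp (d.π j ≫ d.ι j)]
    exact RPoset.le_translate_translate a ε
  have idem : ∀ j, φ j ≫ φ j = φ j := by
    intro j
    refine Presentation.eq_of_tr_eq (fun a => (RPoset.le_translate_translate a ε).trans
      (RPoset.le_translate_translate _ ε)) s4 fun a x => ?_
    rw [← tr_tr (RPoset.le_translate_translate a ε) (RPoset.le_translate_translate _ ε), hφφ,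
      ← tr_tr (RPoset.le_translate_translate a ε) (RPoset.le_translate_translate _ ε), ← hφ, hχ]
    congr 4
    rw [Category.assoc, ← Category.assoc (d.ι j), d.ι_π, Category.id_comp]
  have orth : ∀ i j, j ≠ i → φ j ≫ φ i = 0 := by
    intro i j hij
    refine Presentation.eq_of_tr_eq (fun a => (RPoset.le_translate_translate a ε).trans
      (RPoset.le_translate_translate _ ε)) s4 fun a x => ?_
    rw [← tr_tr (RPoset.le_translate_translate a ε) (RPoset.le_translate_translate _ ε), hφφ,
      Category.assoc, ← Category.assoc (d.ι j), d.ι_π_ne j i hij]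
    simp
  obtain ⟨j₀, hj₀⟩ : ∃ j₀, φ j₀ ≠ 0 := by
    by_contra! h0
    refine hM.1 ((IsZero.iff_id_eq_zero _).2 ?_)
    refine Presentation.eq_of_tr_eq (fun a => RPoset.le_translate_translate a ε) s2 fun a x => ?_
    -- The projections of `N` sum to the identity, so the `χ j` sum to the structure map of `M`.
    have h1 := congrArg (fun q => g (a.translate ε) (ev q (a.translate ε) (f a x))) d.total
    simp only [ev_sum, map_sum, ev_id] at h1
    rw [ev_id, ← hgf, ← h1, ev_zero, map_zero]
    refine Finset.sum_eq_zero fun j _ => ?_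
    rw [← hχ, hφ, h0, ev_zero, map_zero]
  have h1 : φ j₀ = 𝟙 _ := (hM.eq_zero_or_id (idem j₀)).resolve_left hj₀
  have h0 : ∀ j, j ≠ j₀ → φ j = 0 := fun j hj => by
    have := orth j₀ j hj
    rwa [h1, Category.comp_id] at this
  obtain ⟨Z, hZ⟩ := HasZeroObject.zero (C := PersistenceModule k n)
  refine ⟨J, fun j => if j = j₀ then D.toModule else Z, F,
    (Decomp.ofIso j₀ (eqToIso (if_pos rfl)) fun j hj => by rwa [if_neg hj]).isDirectSum,
    d.isDirectSum, fun j => ?_, fun j => .inl (hF j), fun j => ?_⟩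
  · by_cases hj : j = j₀
    · beta_reduce
      rw [if_pos hj]
      exact .inl hM
    · beta_reduce
      rw [if_neg hj]
      exact .inr hZ
  · by_cases hj : j = j₀
    · beta_reduce
      rw [if_pos hj, hj]
      refine Interleaved.mono (ε := ε) (by rw [two_mul]; exact le_self_add) ?_
      rw [interleaved_iff]
      refine ⟨fun a => (ev (d.π j₀) _).comp (f a), fun a => (g a).comp (ev (d.ι j₀) a),
        fun a b hab x => ?_, fun a b hab x => ?_, fun a x => ?_, fun a x => ?_⟩
      · simp only [LinearMap.comp_apply]
        rw [hf, ev_tr]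
      · simp only [LinearMap.comp_apply]
        rw [ev_tr, hg]
      · simp only [LinearMap.comp_apply]
        rw [← ev_comp, ← hχ, hφ, h1, ev_id]
      · simp only [LinearMap.comp_apply]
        rw [hfg, ev_tr, ← ev_comp, d.ι_π, ev_id]
    · beta_reduce
      rw [if_neg hj]
      refine interleaved_of_isZero hZ fun a x => ?_
      have h2 : ∀ b (y : (F j).obj b), ev (d.π j) _ (f _ (g b (ev (d.ι j) b y))) =
          tr (F j) (RPoset.le_translate_translate b ε) y := fun b y => by
        rw [hfg, ev_tr, ← ev_comp, d.ι_π, ev_id]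
      -- The structure map of `F j` over `4ε` passes through `M` twice and contains `χ j`, which
      -- vanishes for `j ≠ j₀`. This is where the matching constant `2 * ε` comes from.
      have h3 : tr (F j) (RPoset.le_translate_translate _ ε)
          (tr (F j) (RPoset.le_translate_translate a ε) x) = 0 := by
        rw [← h2, ← h2 a, ← ev_comp (d.π j) (d.ι j), ← hχ, hφ, h0 j hj, ev_zero, map_zero,
          map_zero, map_zero]
      rw [tr_tr] at h3
      rw [← tr_tr ((RPoset.le_translate_translate a ε).trans
        (RPoset.le_translate_translate _ ε)) (le_double a ε), h3, map_zero]

/-- Structure maps of `N` over `2ε` vanish, and this passes to each summand; every summand is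
therefore matched with a copy of the zero module `M`. -/
theorem matched_of_isZero (hM : IsZero M) {ε : ℝ≥0} (h : Interleaved ε M N)
    {J : Type} [Fintype J] {F : J → PersistenceModule k n}
    (d : Decomp N F) (hF : ∀ j, Indecomposable (F j)) : Matched ε M N := by
  have d' : Decomp M fun _ : J => M :=
    { ι := 0
      π := 0
      ι_π := fun j => hM.eq_of_src _ _
      ι_π_ne := fun i j _ => hM.eq_of_src _ _
      total := hM.eq_of_src _ _ }
  refine ⟨J, fun _ => M, F, d'.isDirectSum, d.isDirectSum, fun _ => .inr hM,
    fun j => .inl (hF j), fun j => interleaved_of_isZero hM fun a x => ?_⟩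
  have h1 := h.symm.tr_eq_zero hM a (ev (d.ι j) a x)
  rw [← ev_tr] at h1
  have h2 := congrArg (fun f => ev f _ (tr (F j) (RPoset.le_translate_translate a ε) x)) (d.ι_π j)
  simp only [ev_comp, ev_id] at h2
  rw [← h2, h1, map_zero]

/-- If `M` is matched, with small error, to an indecomposable module then it is indecomposable
or zero. -/
theorem indecomposable_of_matched {α β : Type} [Fintype α]
    (D : Presentation k n α β) {ε : ℝ≥0}
    (hε : ∀ r : ℝ, r ≤ 2 * ε → D.Stable fun a => a.translate r)
    (hN : Indecomposable N) (h : Matched ε D.toModule N) :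
    Indecomposable D.toModule ∨ IsZero D.toModule := by
  have s2 : D.Stable fun a => (a.translate ε).translate ε := by
    intro x y hxy
    refine hε (2 * ε) le_rfl x y fun c => (hxy c).trans (le_of_eq ?_)
    change D.deg x c + (ε : ℝ) + (ε : ℝ) = D.deg x c + 2 * (ε : ℝ)
    ring
  obtain ⟨J, F, G, hF, hG, indF, -, hFG⟩ := h
  obtain ⟨ι, π, ιπ, ιπ', hι⟩ := hF.exists_proj
  obtain ⟨ι', π', ιπ1, ιπ1', hι'⟩ := hG.exists_proj
  obtain ⟨j₀, hj₀⟩ : ∃ j₀, π' j₀ ≫ ι' j₀ ≠ 0 := by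
    by_contra! h0
    refine hN.1 ((IsZero.iff_id_eq_zero _).2 (hι' _ _ _ fun j => ?_))
    have : ι' j = ι' j ≫ π' j ≫ ι' j := by rw [← Category.assoc, ιπ1, Category.id_comp]
    rw [Category.comp_id, this, h0, comp_zero]
    simp
  have h1 : π' j₀ ≫ ι' j₀ = 𝟙 N := by
    refine (hN.eq_zero_or_id ?_).resolve_left hj₀
    rw [Category.assoc, ← Category.assoc (ι' j₀), ιπ1, Category.id_comp]
  have hG0 : ∀ j, j ≠ j₀ → IsZero (G j) := by
    intro j hj
    rw [IsZero.iff_id_eq_zero, ← ιπ1 j, ← Category.comp_id (ι' j), ← h1, ← Category.assoc,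
      ιπ1' j j₀ hj]
    simp
  have hF0 : ∀ j, j ≠ j₀ → IsZero (F j) := by
    intro j hj
    -- `F j` is `ε`-interleaved with zero, so this endomorphism of `M` dies under the shift by `2ε`,
    -- which detects all endomorphisms by stability of the degrees.
    have h2 : π j ≫ ι j = 0 := by
      refine Presentation.eq_of_tr_eq (fun a => RPoset.le_translate_translate a ε) s2
        fun a x => ?_
      rw [← ev_tr, ev_comp, ev_tr, (hFG j).tr_eq_zero (hG0 j hj), map_zero, ev_zero, map_zero]
    rw [IsZero.iff_id_eq_zero, ← ιπ j, ← Category.comp_id (ι j ≫ π j), ← ιπ j]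
    have : (ι j ≫ π j) ≫ ι j ≫ π j = ι j ≫ (π j ≫ ι j) ≫ π j := by simp
    rw [this, h2]
    simp
  have i : F j₀ ≅ D.toModule :=
    { hom := ι j₀
      inv := π j₀
      hom_inv_id := ιπ j₀
      inv_hom_id := by
        refine hι _ _ _ fun j => ?_
        by_cases hj : j = j₀
        · subst hj
          rw [← Category.assoc, ιπ, Category.id_comp, Category.comp_id]
        · exact (hF0 j hj).eq_of_src _ _ }
  rcases indF j₀ with h | h
  · exact .inl (h.of_iso i)
  · exact .inr (h.of_iso i.symm)

end PersistenceModule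
end

/-! ### Gluing all generators to a short-lived one -/

noncomputable section
namespace PersistenceModule

variable {k : Type u} [Field k] {n : ℕ}

namespace Presentation

/-- Degrees for an indecomposable perturbation of the module presented by `D`: every generator
`e i` gets a thin companion generator (of degree `h i`) which, from degree `q i` on, is the sum of
`e i` and of a thin generator (of degree `g`, killed in degree `g'`) that is common to all `i`. -/
structure Gluing {α β : Type} (D : Presentation k n α β) (δ : ℝ≥0) where
  (e h q : α → RPoset n)
  (g g' : RPoset n)
  r : β → RPoset n
  t : α → ℝ
  e_le_r : ∀ j i, D.coeff j i ≠ 0 → e i ≤ r j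
  g_le_g' : g ≤ g'
  h_le_q : ∀ i, h i ≤ q i
  e_le_q : ∀ i, e i ≤ q i
  g_le_q : ∀ i, g ≤ q i
  -- The inequalities up to `δ` and `2δ` give the interleaving with `D.toModule`.
  e_le_gen : ∀ i, e i ≤ (D.gen i).translate δ
  gen_le_e : ∀ i, D.gen i ≤ (e i).translate δ
  gen_le_h : ∀ i, D.gen i ≤ (h i).translate δ
  r_le_rel : ∀ j, r j ≤ (D.rel j).translate δ
  rel_le_r : ∀ j, D.rel j ≤ (r j).translate δ
  g'_le_g : g' ≤ (g.translate δ).translate δ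
  q_le_h : ∀ i, q i ≤ ((h i).translate δ).translate δ
  g'_le_h : ∀ i, g' ≤ ((h i).translate δ).translate δ
  -- The remaining conditions force most matrix entries of an endomorphism to vanish and give
  -- indecomposability.
  not_e_le_h : ∀ i, ¬ e i ≤ h i
  eq_of_h_le_h : ∀ i j, h j ≤ h i → j = i
  not_g_le_h : ∀ i, ¬ g ≤ h i
  lt_of_e_le_e : ∀ i j, e j ≤ e i → j = i ∨ t j < t i
  not_g_le_e : ∀ i, ¬ g ≤ e i
  not_h_le_e : ∀ i j, ¬ h j ≤ e i
  not_e_le_g : ∀ i, ¬ e i ≤ g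
  not_h_le_g : ∀ i, ¬ h i ≤ g
  not_g'_le_g : ¬ g' ≤ g
  not_q_le_g : ∀ i, ¬ q i ≤ g
  not_g'_le_q : ∀ i, ¬ g' ≤ q i
  coeff_eq_zero : ∀ i j, r j ≤ q i → D.coeff j i = 0

namespace Gluing

variable {α β : Type} {D : Presentation k n α β} {δ : ℝ≥0} (γ : Gluing D δ)

open Classical in
/-- The perturbed presentation. -/
def pres : Presentation k n (α ⊕ Option α) (β ⊕ Option α) where
  gen := Sum.elim γ.e fun i => i.elim γ.g γ.h
  rel := Sum.elim γ.r fun i => i.elim γ.g' γ.q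
  coeff := Sum.elim (fun j => Sum.elim (D.coeff j) 0) fun i => i.elim (Pi.single (.inr none) 1)
    fun i => Pi.single (.inr (some i)) 1 - Pi.single (.inl i) 1 - Pi.single (.inr none) 1
  gen_le_rel := by
    rintro (j | _ | j) (i | _ | i) h
    · exact γ.e_le_r j i h
    · simp at h
    · simp at h
    · simp at h
    · exact γ.g_le_g'
    · simp at h
    · obtain rfl : i = j := by
        by_contra hij
        simp [hij] at h
      exact γ.e_le_q i
    · exact γ.g_le_q j
    · obtain rfl : i = j := by
        by_contra hij
        simp [hij] at h
      exact γ.h_le_q i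

open Classical in
theorem coeff_some (i : α) : γ.pres.coeff (.inr (some i)) =
    Pi.single (M := fun _ => k) (Sum.inr (some i)) 1 -
    Pi.single (M := fun _ => k) (Sum.inl i) 1 - Pi.single (M := fun _ => k) (Sum.inr none) 1 := rfl

theorem coeff_some_mem (i : α) : γ.pres.coeff (.inr (some i)) ∈ γ.pres.R (γ.q i) := by
  have h : γ.pres.rel (.inr (some i)) ≤ γ.q i := le_refl (γ.q i)
  exact coeff_mem_R h

open Classical in
theorem coeff_none : γ.pres.coeff (.inr none) =
    Pi.single (M := fun _ => k) (Sum.inr none) 1 := rfl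

/-- No relation involving `g` is present in degree `g`. With `eq_single_of_mem_G_g`, the module is
one-dimensional there. -/
theorem eq_zero_of_mem_R_g {w : (α ⊕ Option α) → k} (hw : w ∈ γ.pres.R γ.g) :
    w (.inr none) = 0 := by
  have h1 : γ.pres.R γ.g ≤ LinearMap.ker (LinearMap.proj (.inr none) :
      (α ⊕ Option α → k) →ₗ[k] k) := by
    refine R_le_iff.2 fun j hj => ?_
    rcases j with j | _ | j
    · rfl
    · exact absurd hj γ.not_g'_le_g
    · exact absurd hj (γ.not_q_le_g j)
  exact h1 hw

open Classical in
theorem eq_single_of_mem_G_g {w : (α ⊕ Option α) → k} (hw : w ∈ γ.pres.G γ.g) :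
    w = w (.inr none) • Pi.single (.inr none) 1 := by
  funext x
  by_cases hx : w x = 0
  · rcases x with i | _ | i
    · simp [hx]
    · simp
    · simp [hx]
  · have := hw x hx
    rcases x with i | _ | i
    · exact absurd this (γ.not_e_le_g i)
    · simp
    · exact absurd this (γ.not_h_le_g i)

/-- The inclusion of the old generators. -/
def incl (k : Type u) [Field k] (α : Type) : (α → k) →ₗ[k] (α ⊕ Option α → k) where
  toFun v := Sum.elim v 0
  map_add' v w := by ext (i | i) <;> simp
  map_smul' c v := by ext (i | i) <;> simp

/-- The projection to the old generators. -/
def proj (k : Type u) [Field k] (α : Type) : (α ⊕ Option α → k) →ₗ[k] (α → k) where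
  toFun w i := w (.inl i) + w (.inr (some i))
  map_add' v w := by ext i; simp; ring
  map_smul' c v := by ext i; simp; ring

variable [Fintype α]

/-- The map back sends `h i` to the old generator `i` and `g` to zero. One composite is the identity
on generators; the other differs from it by multiples of `g` and of `h i - e i`, which become
relations after `2δ`. -/
theorem interleaved : Interleaved δ D.toModule γ.pres.toModule := by
  classical
  have tm : ∀ {a b : RPoset n}, a ≤ b → a.translate δ ≤ b.translate δ :=
    fun h => RPoset.translate_mono δ h
  refine Presentation.interleaved δ (incl k α) (proj k α) ?_ ?_ ?_ ?_ ?_ ?_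
  · intro p v hv i
    rcases i with i | i
    · intro hi
      exact (γ.e_le_gen i).trans (tm (hv i hi))
    · intro hi
      exact absurd rfl hi
  · intro p
    refine R_le_iff.2 fun j hj => ?_
    exact coeff_mem_R (D := γ.pres) (j := .inl j) ((γ.r_le_rel j).trans (tm hj))
  · intro p v hv i hi
    by_cases h0 : v (.inl i) = 0
    · have h1 : v (.inr (some i)) ≠ 0 := by
        intro h1
        exact hi (by change v (.inl i) + v (.inr (some i)) = 0; rw [h0, h1, add_zero])
      exact (γ.gen_le_h i).trans (tm (hv _ h1))
    · exact (γ.gen_le_e i).trans (tm (hv _ h0))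
  · intro p
    refine R_le_iff.2 fun j hj => ?_
    rcases j with j | _ | j
    · have : proj k α (γ.pres.coeff (.inl j)) = D.coeff j := by
        ext i
        simp [proj, pres]
      rw [Submodule.mem_comap, this]
      exact coeff_mem_R ((γ.rel_le_r j).trans (tm hj))
    · have : proj k α (γ.pres.coeff (.inr none)) = 0 := by
        ext i
        simp [proj, coeff_none]
      rw [Submodule.mem_comap, this]
      exact Submodule.zero_mem _
    · have : proj k α (γ.pres.coeff (.inr (some j))) = 0 := by
        ext i
        simp [proj, coeff_some, Pi.single_apply]
      rw [Submodule.mem_comap, this]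
      exact Submodule.zero_mem _
  · intro p v _
    have : proj k α (incl k α v) = v := by
      ext i
      simp [proj, incl]
    rw [this, sub_self]
    exact Submodule.zero_mem _
  · intro p v hv
    have key : γ.pres.G p ≤ (γ.pres.R ((p.translate δ).translate δ)).comap
        ((incl k α).comp (proj k α) - LinearMap.id) := by
      refine G_le_iff.2 fun x hx => ?_
      rw [Submodule.mem_comap, LinearMap.sub_apply, LinearMap.comp_apply, LinearMap.id_apply]
      have hnone : ∀ {p' : RPoset n}, γ.g' ≤ p' →
          (Pi.single (Sum.inr none) 1 : (α ⊕ Option α) → k) ∈ γ.pres.R p' := fun h =>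
        coeff_mem_R (D := γ.pres) (j := .inr none) h
      rcases x with i | _ | i
      · have : incl k α (proj k α (Pi.single (Sum.inl i) 1)) = Pi.single (Sum.inl i) 1 := by
          ext (j | j) <;> simp [incl, proj, Pi.single_apply]
        rw [this, sub_self]
        exact Submodule.zero_mem _
      · have : proj k α (Pi.single (Sum.inr none) 1) = 0 := by
          ext i
          simp [proj]
        rw [this, map_zero, zero_sub]
        exact Submodule.neg_mem _ (hnone (γ.g'_le_g.trans (tm (tm hx))))
      · have : incl k α (proj k α (Pi.single (Sum.inr (some i)) 1)) -
            Pi.single (Sum.inr (some i)) 1 = -γ.pres.coeff (.inr (some i)) -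
            Pi.single (Sum.inr none) 1 := by
          rw [coeff_some]
          ext (j | _ | j) <;> simp [incl, proj, Pi.single_apply]
        rw [this]
        exact Submodule.sub_mem _ (Submodule.neg_mem _
          (coeff_mem_R ((γ.q_le_h i).trans (tm (tm hx)))))
          (hnone ((γ.g'_le_h i).trans (tm (tm hx))))
    exact key hv

/-- Elements of `R (q i)` satisfy two linear equations. -/
theorem eqs_of_mem_R {i : α} {w : (α ⊕ Option α) → k} (hw : w ∈ γ.pres.R (γ.q i)) :
    w (.inr none) + ∑ l, w (.inr (some l)) = 0 ∧ w (.inl i) + w (.inr (some i)) = 0 := by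
  classical
  -- Each relation `h l - e l - g` contributes `1 - 1` to this functional, and the old relations do
  -- not involve `g` or the `h l`; the relation `g = 0` is not yet present in degree `q i`.
  have h1 : γ.pres.R (γ.q i) ≤ LinearMap.ker
      ((LinearMap.proj (.inr none) + ∑ l, LinearMap.proj (.inr (some l)) :
        (α ⊕ Option α → k) →ₗ[k] k)) := by
    refine R_le_iff.2 fun j hj => ?_
    rw [LinearMap.mem_ker, LinearMap.add_apply, LinearMap.sum_apply]
    simp only [LinearMap.proj_apply]
    rcases j with j | _ | j
    · simp [pres]
    · exact absurd hj (γ.not_g'_le_q i)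
    · simp [coeff_some, Pi.single_apply]
  have h2 : γ.pres.R (γ.q i) ≤ LinearMap.ker
      ((LinearMap.proj (.inl i) + LinearMap.proj (.inr (some i)) :
        (α ⊕ Option α → k) →ₗ[k] k)) := by
    refine R_le_iff.2 fun j hj => ?_
    rw [LinearMap.mem_ker, LinearMap.add_apply]
    simp only [LinearMap.proj_apply]
    rcases j with j | _ | j
    · simpa [pres] using γ.coeff_eq_zero i j hj
    · exact absurd hj (γ.not_g'_le_q i)
    · simp [coeff_some, Pi.single_apply]
  constructor
  · have := h1 hw
    rwa [LinearMap.mem_ker, LinearMap.add_apply, LinearMap.sum_apply] at this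
  · exact h2 hw

theorem e_none_ne_zero : γ.pres.e (.inr none) ≠ 0 := by
  intro h
  have := γ.eq_zero_of_mem_R_g (cls_eq_zero.1 h)
  simp at this

/-- If `ψ` kills `g`, the relation `h i = e i + g` gives `ψ (h i) = ψ (e i)` in degree `q i`.
Comparing coefficients there makes the diagonal entries of `ψ` at `e i` and `h i` zero. Then `ψ` is
strictly triangular, and an idempotent of this kind vanishes. -/
theorem eq_zero_of_idempotent {ψ : γ.pres.toModule ⟶ γ.pres.toModule} (hψ : ψ ≫ ψ = ψ)
    (h0 : ev ψ _ (γ.pres.e (.inr none)) = 0) : ψ = 0 := by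
  classical
  obtain ⟨L, hG, hR, hL⟩ := exists_lift (D := γ.pres) (D' := γ.pres) (T := fun a => a)
    (fun _ _ h => h) (ev ψ) (fun _ _ h x => ev_tr ψ h x)
  have hψL : ∀ p (v : γ.pres.G p), ev ψ p (γ.pres.cls p v) = γ.pres.cls p ⟨L v, hG p v.2⟩ := by
    intro p v
    rw [hL]
    rfl
  have idem : ∀ p (v : γ.pres.G p), L (L v) - L v ∈ γ.pres.R p := by
    intro p v
    have h1 := congrArg (fun f => ev f p (γ.pres.cls p v)) hψ
    simp only [ev_comp, hψL] at h1
    exact cls_eq_cls.1 h1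
  let col : (α ⊕ Option α) → (α ⊕ Option α) → k := fun x => L (Pi.single x 1)
  have colG : ∀ x, col x ∈ γ.pres.G (γ.pres.gen x) := fun x =>
    hG _ (single_mem_G (D := γ.pres) le_rfl 1)
  have col0 : ∀ x y, ¬ γ.pres.gen y ≤ γ.pres.gen x → col x y = 0 := fun x y h => by
    by_contra h'
    exact h (colG x y h')
  have col_iff : ∀ x, ev ψ _ (γ.pres.e x) = 0 ↔ col x ∈ γ.pres.R (γ.pres.gen x) := fun x => by
    rw [Presentation.e, hψL, cls_eq_zero]
    change L _ ∈ _ ↔ L _ ∈ _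
    congr!
  have colsum : ∀ v, L v = ∑ x, v x • col x := fun v => by
    conv_lhs => rw [pi_eq_sum_univ' v]
    rw [map_sum]
    refine Finset.sum_congr rfl fun x _ => ?_
    rw [map_smul]
  have killed : ∀ x, (∀ y, col x y ≠ 0 → col y ∈ γ.pres.R (γ.pres.gen y)) →
      col x ∈ γ.pres.R (γ.pres.gen x) := by
    intro x hx
    have h1 : L (col x) ∈ γ.pres.R (γ.pres.gen x) := by
      rw [colsum]
      refine Submodule.sum_mem _ fun y _ => ?_
      by_cases hy : col x y = 0
      · rw [hy, zero_smul]
        exact Submodule.zero_mem _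
      · exact Submodule.smul_mem _ _ (R_mono (colG x y hy) (hx y hy))
    have h2 := idem _ ⟨_, single_mem_G (le_refl (γ.pres.gen x)) 1⟩
    have h3 := Submodule.sub_mem _ h1 h2
    rwa [sub_sub_cancel] at h3
  have hg : col (.inr none) = 0 := by
    have h1 := γ.eq_zero_of_mem_R_g ((col_iff (.inr none)).1 h0)
    have h2 := γ.eq_single_of_mem_G_g (colG (.inr none))
    rwa [h1, zero_smul] at h2
  have diag : ∀ i, col (.inr (some i)) (.inr (some i)) = 0 ∧ col (.inl i) (.inl i) = 0 := by
    intro i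
    have h1 : col (.inr (some i)) - col (.inl i) - col (.inr none) ∈ γ.pres.R (γ.q i) := by
      have h := hR _ (γ.coeff_some_mem i)
      rwa [Submodule.mem_comap, coeff_some, map_sub, map_sub] at h
    rw [hg, sub_zero] at h1
    obtain ⟨h2, h3⟩ := γ.eqs_of_mem_R h1
    simp only [Pi.sub_apply] at h2 h3
    rw [col0 (.inr (some i)) (.inr none) (γ.not_g_le_h i),
      col0 (.inl i) (.inr none) (γ.not_g_le_e i), sub_zero, zero_add,
      Finset.sum_eq_single i, col0 (.inl i) (.inr (some i)) (γ.not_h_le_e i i), sub_zero] at h2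
    · rw [h2, col0 (.inr (some i)) (.inl i) (γ.not_e_le_h i),
        col0 (.inl i) (.inr (some i)) (γ.not_h_le_e i i)] at h3
      exact ⟨h2, by simpa using h3⟩
    · intro l _ hl
      rw [col0 (.inl i) (.inr (some l)) (γ.not_h_le_e i l),
        col0 (.inr (some i)) (.inr (some l)) fun h => hl (γ.eq_of_h_le_h i l h), sub_zero]
    · simp
  -- Only `e j` with `t j < t i` can occur in `ψ (e i)`, since the diagonal entry is zero; hence
  -- induction along `t`.
  have kill_e : ∀ i, col (.inl i) ∈ γ.pres.R (γ.e i) := by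
    have wf : WellFounded (fun i j : α => γ.t i < γ.t j) := by
      have : IsTrans α fun i j => γ.t i < γ.t j := ⟨fun _ _ _ => lt_trans⟩
      have : Std.Irrefl fun i j : α => γ.t i < γ.t j := ⟨fun _ => lt_irrefl _⟩
      exact Finite.wellFounded_of_trans_of_irrefl _
    intro i
    induction i using wf.induction with
    | _ i ih =>
      refine killed (.inl i) fun y hy => ?_
      have h1 := colG (.inl i) y hy
      rcases y with j | _ | j
      · rcases γ.lt_of_e_le_e i j h1 with rfl | h2
        · exact absurd (diag j).2 hy
        · exact ih j h2
      · exact absurd h1 (γ.not_g_le_e i)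
      · exact absurd h1 (γ.not_h_le_e i j)
  refine eq_of_e fun x => ?_
  rw [ev_zero, col_iff]
  rcases x with i | _ | i
  · exact kill_e i
  · rw [hg]
    exact Submodule.zero_mem _
  · refine killed _ fun y hy => ?_
    have h1 := colG _ y hy
    rcases y with j | _ | j
    · exact kill_e j
    · exact absurd h1 (γ.not_g_le_h i)
    · obtain rfl := γ.eq_of_h_le_h i j h1
      exact absurd (diag j).1 hy

/-- An idempotent acts on the line in degree `g` by a scalar `c` with `c² = c`. For `c = 0` it
vanishes, and for `c = 1` its complement does. -/
theorem indecomposable : Indecomposable γ.pres.toModule := by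
  classical
  refine indecomposable_of_forall_idempotent ?_ fun ψ hψ => ?_
  · intro hz
    exact γ.e_none_ne_zero (isZero_iff.1 hz _ _)
  · obtain ⟨v, hv⟩ := cls_surjective _ (ev ψ _ (γ.pres.e (.inr none)))
    obtain ⟨c, hc⟩ : ∃ c : k, ev ψ _ (γ.pres.e (.inr none)) = c • γ.pres.e (.inr none) := by
      refine ⟨(v : (α ⊕ Option α) → k) (.inr none), ?_⟩
      rw [← hv, Presentation.e, ← map_smul]
      congr 1
      refine Subtype.ext ((γ.eq_single_of_mem_G_g v.2).trans ?_)
      ext x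
      simp [Pi.single_apply]
    have h1 := congrArg (fun f => ev f _ (γ.pres.e (.inr none))) hψ
    simp only [ev_comp, hc, map_smul] at h1
    rw [smul_smul, ← sub_eq_zero, ← sub_smul] at h1
    have h2 := (smul_eq_zero.1 h1).resolve_right γ.e_none_ne_zero
    have h3 : c * (c - 1) = 0 := by rw [← h2]; ring
    rcases mul_eq_zero.1 h3 with h | h
    · left
      exact γ.eq_zero_of_idempotent hψ (by rw [hc, h, zero_smul])
    · right
      have : 𝟙 _ - ψ = 0 := γ.eq_zero_of_idempotent (by simp [hψ]) (by
        rw [ev_sub, ev_id, hc, sub_eq_zero.1 h, one_smul, sub_self])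
      exact (sub_eq_zero.1 this).symm

end Gluing

end Presentation
end PersistenceModule
end

/-! ### Choosing the degrees of the gluing -/

noncomputable section
namespace PersistenceModule

/-- Add small multiples `s * (N i + 1)` with distinct slopes `N i + 1`; two values collide for only
finitely many `s`, and these are avoided. -/
theorem exists_injective_perturbation {α : Type} [Fintype α] (a : α → ℝ) {δ : ℝ} (hδ : 0 < δ) :
    ∃ t : α → ℝ, Function.Injective t ∧ ∀ i, a i < t i ∧ t i < a i + δ := by
  classical
  let e := Fintype.equivFin α
  let p : ℝ := Fintype.card α
  have hp : 0 ≤ p := Nat.cast_nonneg _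
  let N : α → ℝ := fun i => ((e i : ℕ) : ℝ)
  have hN : ∀ i, 0 ≤ N i ∧ N i + 1 ≤ p := fun i =>
    ⟨Nat.cast_nonneg _, by
      have h : (e i : ℕ) + 1 ≤ Fintype.card α := (e i).2
      change ((e i : ℕ) : ℝ) + 1 ≤ ((Fintype.card α : ℕ) : ℝ)
      exact_mod_cast h⟩
  have hNinj : ∀ i j, N i = N j → i = j := fun i j h =>
    e.injective (Fin.ext (Nat.cast_injective (R := ℝ) h))
  let bad : Finset ℝ := Finset.univ.image fun x : α × α => (a x.2 - a x.1) / (N x.1 - N x.2)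
  obtain ⟨s, hs, hsbad⟩ :=
    (Set.Ioo_infinite (div_pos hδ (by linarith : 0 < p + 1))).exists_notMem_finset bad
  have hs2 : s * (p + 1) < δ := (lt_div_iff₀ (by linarith)).1 hs.2
  refine ⟨fun i => a i + s * (N i + 1), fun i j h => ?_, fun i => ⟨?_, ?_⟩⟩
  · by_contra hij
    have hne : N i - N j ≠ 0 := fun h0 => hij (hNinj i j (sub_eq_zero.1 h0))
    refine hsbad (Finset.mem_image.2 ⟨(i, j), Finset.mem_univ _, ?_⟩)
    rw [div_eq_iff hne]
    simp only at h
    linarith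
  · have := mul_pos hs.1 (by linarith [(hN i).1] : 0 < N i + 1)
    linarith
  · have := mul_le_mul_of_nonneg_left (by linarith [(hN i).2] : N i + 1 ≤ p + 1) hs.1.le
    linarith

theorem exists_bound {α : Type} [Fintype α] {n : ℕ} (x : α → RPoset n) (δ : ℝ) :
    ∃ W : ℝ, δ < W ∧ ∀ i c, x i c + δ < W ∧ -W < x i c - δ := by
  -- The extra point `none` puts `|δ|` among the bounded quantities even if there are no coordinates
  -- to bound.
  obtain ⟨W, hW⟩ := (Set.finite_range fun p : Option (α × Fin n) =>
    p.elim (|δ|) fun p => |x p.1 p.2| + |δ|).bddAbove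
  refine ⟨W + 1, ?_, fun i c => ?_⟩
  · have := hW ⟨none, rfl⟩
    have h2 := le_abs_self δ
    simp only [Option.elim_none] at this
    linarith
  · have := hW ⟨some (i, c), rfl⟩
    simp only [Option.elim_some] at this
    have h1 := abs_le.1 (le_refl |x i c|)
    have h2 := abs_le.1 (le_refl |δ|)
    constructor <;> linarith

variable {k : Type u} [Field k] {n : ℕ}

namespace Presentation

/-- Everything happens in two coordinates, the others being raised to the large bound `W`. In the
first, the `e i` are moved apart to distinct values `t i`. The degrees `h i` lie along a line of
negative slope, far above the `e i` in the second coordinate, and thus form an antichain; this needs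
`n ≥ 2`. -/
theorem exists_gluing {α β : Type} [Fintype α] (hn : 2 ≤ n) (D : Presentation k n α β) {δ : ℝ≥0}
    (hδ : 0 < δ) : Nonempty (Gluing D δ) := by
  have hδ' : (0 : ℝ) < δ := hδ
  let c₀ : Fin n := ⟨0, by omega⟩
  let c₁ : Fin n := ⟨1, by omega⟩
  have h01 : c₁ ≠ c₀ := by simp [c₀, c₁, Fin.ext_iff]
  obtain ⟨t, ht, hta⟩ := exists_injective_perturbation (fun i => D.gen i c₀) hδ'
  obtain ⟨W, hδW, hW⟩ := exists_bound D.gen δ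
  have hW0 : 0 < W := by linarith
  -- Since `0 < t i + W < 2 * W`, this slope keeps the drops `ζ * (t i + W)` strictly between `0`
  -- and `δ`.
  let ζ : ℝ := δ / (2 * W)
  have hζ : 0 < ζ := div_pos hδ' (by linarith)
  have hζW : ζ * (2 * W) = δ := div_mul_cancel₀ _ (by linarith)
  have htW : ∀ i, -W + δ < t i ∧ t i < W := fun i =>
    ⟨by linarith [(hta i).1, (hW i c₀).2], by linarith [(hta i).2, (hW i c₀).1]⟩
  have hs : ∀ i, 0 < ζ * (t i + W) ∧ ζ * (t i + W) < δ := fun i => by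
    refine ⟨mul_pos hζ (by linarith [(htW i).1]), ?_⟩
    rw [← hζW]
    exact mul_lt_mul_of_pos_left (by linarith [(htW i).2]) hζ
  let pt : ℝ → ℝ → RPoset n := fun x y c => if c = c₀ then x else if c = c₁ then y else W
  have pt0 : ∀ x y, pt x y c₀ = x := fun x y => if_pos rfl
  have pt1 : ∀ x y, pt x y c₁ = y := fun x y => (if_neg h01).trans (if_pos rfl)
  have pt_le : ∀ {x y x' y' : ℝ}, x ≤ x' → y ≤ y' → pt x y ≤ pt x' y' := by
    intro x y x' y' hx hy c
    change (if c = c₀ then x else if c = c₁ then y else W) ≤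
      (if c = c₀ then x' else if c = c₁ then y' else W)
    split_ifs <;> first | assumption | exact le_rfl
  have pt_le_tr : ∀ {x y x' y' : ℝ}, x ≤ x' + δ + δ → y ≤ y' + δ + δ →
      pt x y ≤ ((pt x' y').translate δ).translate δ := by
    intro x y x' y' hx hy c
    change (if c = c₀ then x else if c = c₁ then y else W) ≤
      (if c = c₀ then x' else if c = c₁ then y' else W) + δ + δ
    split_ifs <;> linarith
  let e : α → RPoset n := fun i c => if c = c₀ then t i else D.gen i c
  have e0 : ∀ i, e i c₀ = t i := fun i => if_pos rfl
  have e1 : ∀ i, e i c₁ = D.gen i c₁ := fun i => if_neg h01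
  let s : α → ℝ := fun i => 2 * W - ζ * (t i + W)
  have hs' : ∀ i, 2 * W - δ < s i ∧ s i < 2 * W := fun i =>
    ⟨by linarith [(hs i).2], by linarith [(hs i).1]⟩
  -- Raising relations by `δ` in the first coordinate, while generators rise by less, puts every
  -- relation that involves generator `i` beyond `q i`.
  let r : β → RPoset n := fun j c => if c = c₀ then D.rel j c + δ else D.rel j c
  have r0 : ∀ j, r j c₀ = D.rel j c₀ + δ := fun j => if_pos rfl
  exact ⟨{
    e := e
    h := fun i => pt (t i - δ) (s i)
    q := fun i => pt (t i) (2 * W)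
    g := pt (-W) (2 * W)
    g' := pt (-W) (2 * W + δ)
    r := r
    t := t
    e_le_r := fun j i h c => by
      have h1 : D.gen i c ≤ D.rel j c := D.gen_le_rel j i h c
      change (if c = c₀ then t i else D.gen i c) ≤
        (if c = c₀ then D.rel j c + δ else D.rel j c)
      split_ifs with hc
      · subst hc
        linarith [(hta i).2]
      · exact h1
    g_le_g' := pt_le le_rfl (by linarith)
    h_le_q := fun i => pt_le (by linarith) (hs' i).2.le
    e_le_q := fun i c => by
      have h1 := (hW i c).1
      change (if c = c₀ then t i else D.gen i c) ≤
        (if c = c₀ then t i else if c = c₁ then 2 * W else W)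
      split_ifs <;> linarith
    g_le_q := fun i => pt_le (by linarith [(htW i).1]) le_rfl
    e_le_gen := fun i c => by
      change (if c = c₀ then t i else D.gen i c) ≤ D.gen i c + δ
      split_ifs with hc
      · subst hc
        exact (hta i).2.le
      · linarith
    gen_le_e := fun i c => by
      change D.gen i c ≤ (if c = c₀ then t i else D.gen i c) + δ
      split_ifs with hc
      · subst hc
        linarith [(hta i).1]
      · linarith
    gen_le_h := fun i c => by
      have h1 := (hW i c).1
      have h2 := (hs' i).1
      change D.gen i c ≤ (if c = c₀ then t i - δ else if c = c₁ then s i else W) + δ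
      split_ifs with hc
      · subst hc
        linarith [(hta i).1]
      · linarith
      · linarith
    r_le_rel := fun j c => by
      change (if c = c₀ then D.rel j c + δ else D.rel j c) ≤ D.rel j c + δ
      split_ifs <;> linarith
    rel_le_r := fun j c => by
      change D.rel j c ≤ (if c = c₀ then D.rel j c + δ else D.rel j c) + δ
      split_ifs <;> linarith
    g'_le_g := pt_le_tr (by linarith) (by linarith)
    q_le_h := fun i => pt_le_tr (by linarith) (by linarith [(hs' i).1])
    g'_le_h := fun i => pt_le_tr (by linarith [(htW i).1]) (by linarith [(hs' i).1])
    not_e_le_h := fun i h => by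
      have := h c₀
      rw [e0, pt0] at this
      linarith
    eq_of_h_le_h := fun i j h => by
      have h0 := h c₀
      have h1 := h c₁
      rw [pt0, pt0] at h0
      rw [pt1, pt1] at h1
      have h2 : ζ * (t i + W) ≤ ζ * (t j + W) := by linarith
      have h3 := le_of_mul_le_mul_left h2 hζ
      exact ht (by linarith)
    not_g_le_h := fun i h => by
      have := h c₁
      rw [pt1, pt1] at this
      linarith [(hs' i).2]
    lt_of_e_le_e := fun i j h => by
      have := h c₀
      rw [e0, e0] at this
      rcases this.lt_or_eq with h | h
      · exact .inr h
      · exact .inl (ht h)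
    not_g_le_e := fun i h => by
      have := h c₁
      rw [pt1, e1] at this
      linarith [(hW i c₁).1]
    not_h_le_e := fun i j h => by
      have := h c₁
      rw [pt1, e1] at this
      linarith [(hW i c₁).1, (hs' j).1]
    not_e_le_g := fun i h => by
      have := h c₀
      rw [pt0, e0] at this
      linarith [(htW i).1]
    not_h_le_g := fun i h => by
      have := h c₀
      rw [pt0, pt0] at this
      linarith [(htW i).1]
    not_g'_le_g := fun h => by
      have := h c₁
      rw [pt1, pt1] at this
      linarith
    not_q_le_g := fun i h => by
      have := h c₀
      rw [pt0, pt0] at this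
      linarith [(htW i).1]
    not_g'_le_q := fun i h => by
      have := h c₁
      rw [pt1, pt1] at this
      linarith
    coeff_eq_zero := fun i j h => by
      by_contra h'
      have h1 := h c₀
      have h2 : D.gen i c₀ ≤ D.rel j c₀ := D.gen_le_rel j i h' c₀
      rw [pt0, r0] at h1
      linarith [(hta i).2] }⟩

end Presentation
end PersistenceModule
end

/-! ### Presentations by matrices and cokernels of maps of free modules -/

noncomputable section
namespace PersistenceModule

variable {k : Type u} [Field k] {n : ℕ} {M N : PersistenceModule k n}

theorem ev_surjective_of_epi (f : M ⟶ N) [Epi f] (a : RPoset n) :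
    Function.Surjective (ev f a) := by
  have : Epi (f.app a) := inferInstance
  have : Epi ((forget₂ (FGModuleCat k) (ModuleCat k)).map (f.app a)) := inferInstance
  exact (ModuleCat.epi_iff_surjective _).1 this

theorem mem_freeSubmodule {a p : RPoset n} {x : k} :
    x ∈ freeSubmodule k a p ↔ (x ≠ 0 → a ≤ p) := by
  unfold freeSubmodule
  split_ifs with h
  · simp [h]
  · simp [h]

/-- The underlying scalar of an element of a free module. -/
def scalar (a p : RPoset n) : (free k a).obj p →ₗ[k] k := (freeSubmodule k a p).subtype

theorem scalar_injective (a p : RPoset n) : Function.Injective (scalar (k := k) a p) :=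
  Subtype.val_injective

theorem le_of_scalar_ne_zero {a p : RPoset n} {x : (free k a).obj p}
    (h : scalar a p x ≠ 0) : a ≤ p :=
  mem_freeSubmodule.1 x.2 h

theorem exists_scalar_eq {a p : RPoset n} {c : k} (h : c ≠ 0 → a ≤ p) :
    ∃ x, scalar (k := k) a p x = c :=
  ⟨⟨c, mem_freeSubmodule.2 h⟩, rfl⟩

theorem scalar_tr (a : RPoset n) {p q : RPoset n} (h : p ≤ q) (x : (free k a).obj p) :
    scalar a q (tr (free k a) h x) = scalar a p x := rfl

variable {α β : Type} [Fintype α] [Fintype β]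

section coords

variable (a : α → RPoset n)

/-- The coordinates of an element of a finite free module. -/
def coords (p : RPoset n) : (⨁ fun i => free k (a i)).obj p →ₗ[k] (α → k) :=
  LinearMap.pi fun i => (scalar (a i) p).comp (ev (biproduct.π (fun i => free k (a i)) i) p)

theorem coords_apply (p : RPoset n) (x : (⨁ fun i => free k (a i)).obj p) (i : α) :
    coords a p x i = scalar (a i) p (ev (biproduct.π (fun i => free k (a i)) i) p x) := rfl

theorem coords_tr {p q : RPoset n} (h : p ≤ q) (x : (⨁ fun i => free k (a i)).obj p) :
    coords a q (tr _ h x) = coords a p x := by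
  funext i
  rw [coords_apply, ev_tr, scalar_tr, coords_apply]

theorem sum_π_ι (p : RPoset n) (x : (⨁ fun i => free k (a i)).obj p) :
    x = ∑ i, ev (biproduct.ι (fun i => free k (a i)) i) p
      (ev (biproduct.π (fun i => free k (a i)) i) p x) := by
  have h := congrArg (fun f => ev f p x) (biproduct.total (f := fun i => free k (a i)))
  simp only [ev_sum, ev_comp, ev_id] at h
  exact h.symm

theorem coords_injective (p : RPoset n) : Function.Injective (coords (k := k) a p) := by
  intro x y h
  rw [sum_π_ι a p x, sum_π_ι a p y]
  refine Finset.sum_congr rfl fun i _ => ?_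
  congr 1
  exact scalar_injective _ _ (congrFun h i)

theorem le_of_coords_ne_zero {p : RPoset n} {x : (⨁ fun i => free k (a i)).obj p} {i : α}
    (h : coords a p x i ≠ 0) : a i ≤ p := le_of_scalar_ne_zero h

theorem exists_coords_eq {p : RPoset n} {v : α → k} (h : ∀ i, v i ≠ 0 → a i ≤ p) :
    ∃ x, coords a p x = v := by
  classical
  choose y hy using fun i => exists_scalar_eq (h i)
  refine ⟨∑ i, ev (biproduct.ι (fun i => free k (a i)) i) p (y i), ?_⟩
  funext j
  rw [coords_apply, map_sum, map_sum, Finset.sum_eq_single j]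
  · rw [← ev_comp, biproduct.ι_π_self, ev_id, hy]
  · intro i _ hij
    rw [← ev_comp, biproduct.ι_π_ne _ hij, ev_zero, map_zero]
  · simp

end coords

variable {a : α → RPoset n} {b : β → RPoset n}

/-- The element `1` in degree `b`. -/
def one (b : RPoset n) : (free k b).obj b := ⟨1, mem_freeSubmodule.2 fun _ => le_rfl⟩

theorem scalar_one (b : RPoset n) : scalar (k := k) b b (one b) = 1 := rfl

theorem eq_smul_one {b p : RPoset n} (x : (free k b).obj p) (h : b ≤ p) :
    x = scalar b p x • tr (free k b) h (one b) := by
  apply scalar_injective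
  rw [map_smul, scalar_tr, scalar_one, smul_eq_mul, mul_one]

/-- The presentation given by the matrix of a morphism between finite free modules. -/
def presOfHom (f : (⨁ fun j => free k (b j)) ⟶ (⨁ fun i => free k (a i))) :
    Presentation k n α β where
  gen := a
  rel := b
  coeff j := coords a (b j) (ev f (b j) (ev (biproduct.ι (fun j => free k (b j)) j) (b j)
    (one (b j))))
  gen_le_rel _ _ h := le_of_coords_ne_zero a h

variable (f : (⨁ fun j => free k (b j)) ⟶ (⨁ fun i => free k (a i)))

theorem coords_ev (p : RPoset n) (x : (⨁ fun j => free k (b j)).obj p) :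
    coords a p (ev f p x) = ∑ j, coords b p x j • (presOfHom f).coeff j := by
  conv_lhs => rw [sum_π_ι b p x]
  rw [map_sum, map_sum]
  refine Finset.sum_congr rfl fun j _ => ?_
  rw [coords_apply]
  generalize ev (biproduct.π (fun j => free k (b j)) j) p x = y
  by_cases h : b j ≤ p
  · conv_lhs => rw [eq_smul_one y h]
    rw [map_smul, map_smul, map_smul, ev_tr, ev_tr, coords_tr]
    rfl
  · have h0 : scalar (b j) p y = 0 := by
      by_contra h'
      exact h (le_of_scalar_ne_zero h')
    have h1 : y = 0 := scalar_injective _ _ (by rw [h0, map_zero])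
    rw [h0, h1, map_zero, map_zero, map_zero, zero_smul]

/-- In coordinates, the image of `f` at `p` is exactly the relation space of its matrix; this
identifies the cokernel with the presented module. -/
theorem exists_ev_coords_iff (p : RPoset n) (v : α → k) :
    (∃ x, coords a p (ev f p x) = v) ↔ v ∈ (presOfHom f).R p := by
  classical
  constructor
  · rintro ⟨x, rfl⟩
    rw [coords_ev]
    refine Submodule.sum_mem _ fun j _ => ?_
    by_cases h : coords b p x j = 0
    · rw [h, zero_smul]
      exact Submodule.zero_mem _
    · exact Submodule.smul_mem _ _
        (Presentation.coeff_mem_R (D := presOfHom f) (le_of_coords_ne_zero b h))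
  · have : (presOfHom f).R p ≤ LinearMap.range ((coords a p).comp (ev f p)) := by
      refine Presentation.R_le_iff.2 fun j hj => ?_
      obtain ⟨x, hx⟩ := exists_coords_eq (k := k) b (p := p) (v := Pi.single j 1) fun i hi => by
        by_cases h : i = j
        · rw [h]
          exact hj
        · simp [h] at hi
      refine ⟨x, ?_⟩
      rw [LinearMap.comp_apply, coords_ev, hx, Finset.sum_eq_single j]
      · simp
      · intro i _ h
        simp [h]
      · simp
    intro hv
    exact this hv

/-- The projection from the free module on the generators to the presented module. -/
def toPres : (⨁ fun i => free k (a i)) ⟶ (presOfHom f).toModule :=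
  homMk (fun p => ((presOfHom f).cls p).comp
    ((coords a p).codRestrict _ fun _ _ => le_of_coords_ne_zero a)) (by
    intro p q h x
    refine congrArg ((presOfHom f).cls q) (Subtype.ext ?_)
    exact coords_tr a h x)

theorem ev_toPres_eq_zero {p : RPoset n} {x : (⨁ fun i => free k (a i)).obj p} :
    ev (toPres f) p x = 0 ↔ ∃ y, ev f p y = x := by
  have h : ev (toPres f) p x = 0 ↔ coords a p x ∈ (presOfHom f).R p :=
    Presentation.cls_eq_zero
  rw [h, ← exists_ev_coords_iff]
  exact exists_congr fun y => (coords_injective a p).eq_iff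

theorem ev_toPres_surjective (p : RPoset n) : Function.Surjective (ev (toPres f) p) := by
  intro y
  obtain ⟨v, rfl⟩ := Presentation.cls_surjective p y
  obtain ⟨x, hx⟩ := exists_coords_eq (k := k) a (p := p) (v := v) v.2
  exact ⟨x, congrArg ((presOfHom f).cls p) (Subtype.ext hx)⟩

theorem cokernel_iso_toModule : Nonempty (cokernel f ≅ (presOfHom f).toModule) := by
  have w : f ≫ toPres f = 0 := ext_ev fun p x => by
    rw [ev_comp, (ev_toPres_eq_zero f).2 ⟨x, rfl⟩, ev_zero]
  have hπ : ∀ p x, ev (cokernel.desc f (toPres f) w) p (ev (cokernel.π f) p x) =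
      ev (toPres f) p x := fun p x => by rw [← ev_comp, cokernel.π_desc]
  have : IsIso (cokernel.desc f (toPres f) w) := by
    refine isIso_of_bijective _ fun p => ⟨?_, fun y => ?_⟩
    · rw [← LinearMap.ker_eq_bot, LinearMap.ker_eq_bot']
      intro z hz
      obtain ⟨x, rfl⟩ := ev_surjective_of_epi (cokernel.π f) p z
      rw [hπ] at hz
      obtain ⟨y, rfl⟩ := (ev_toPres_eq_zero f).1 hz
      rw [← ev_comp, cokernel.condition, ev_zero]
    · obtain ⟨x, rfl⟩ := ev_toPres_surjective f p y
      exact ⟨_, hπ p x⟩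
  exact ⟨asIso (cokernel.desc f (toPres f) w)⟩

theorem FinitelyPresentable.exists_presentation (h : M.FinitelyPresentable) :
    ∃ (p q : ℕ) (D : Presentation k n (Fin p) (Fin q)), Nonempty (M ≅ D.toModule) := by
  obtain ⟨p, q, a, b, f, ⟨e⟩⟩ := h
  obtain ⟨e'⟩ := cokernel_iso_toModule f
  exact ⟨p, q, presOfHom f, ⟨e ≪≫ e'⟩⟩

open Classical in
/-- Multiplication by `c` as a morphism of free modules. -/
def freeHom (a b : RPoset n) (c : k) (h : c ≠ 0 → a ≤ b) : free k b ⟶ free k a :=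
  homMk (fun p => LinearMap.codRestrict (freeSubmodule k a p) (c • scalar b p) fun x => by
    rw [mem_freeSubmodule, LinearMap.smul_apply, smul_eq_mul]
    intro hx
    exact (h (left_ne_zero_of_mul hx)).trans (le_of_scalar_ne_zero (right_ne_zero_of_mul hx)))
    (fun _ _ => rfl)

theorem scalar_freeHom {a b : RPoset n} {c : k} {h : c ≠ 0 → a ≤ b} (p : RPoset n)
    (x : (free k b).obj p) : scalar a p (ev (freeHom a b c h) p x) = c * scalar b p x := rfl

/-- The coefficient matrix itself defines the morphism; `gen_le_rel` makes its entries morphisms of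
free modules. -/
theorem exists_presOfHom_eq (D : Presentation k n α β) :
    ∃ f : (⨁ fun j => free k (D.rel j)) ⟶ (⨁ fun i => free k (D.gen i)), presOfHom f = D := by
  let f : (⨁ fun j => free k (D.rel j)) ⟶ (⨁ fun i => free k (D.gen i)) :=
    biproduct.matrix fun j i => freeHom (D.gen i) (D.rel j) (D.coeff j i) (D.gen_le_rel j i)
  refine ⟨f, ?_⟩
  have : (presOfHom f).coeff = D.coeff := by
    funext j i
    change coords D.gen (D.rel j) _ i = _
    rw [coords_apply, ← ev_comp, ← ev_comp, biproduct.matrix_π,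
      biproduct.ι_desc, scalar_freeHom, scalar_one, mul_one]
  cases D
  simp only [presOfHom] at this ⊢
  congr

theorem Presentation.finitelyPresentable (D : Presentation k n α β) :
    D.toModule.FinitelyPresentable := by
  obtain ⟨f, hf⟩ := exists_presOfHom_eq D
  obtain ⟨i⟩ := cokernel_iso_toModule f
  rw [hf] at i
  let eα := (Fintype.equivFin α).symm
  let eβ := (Fintype.equivFin β).symm
  let iα := biproduct.reindex eα fun i => free k (D.gen i)
  let iβ := biproduct.reindex eβ fun i => free k (D.rel i)
  refine ⟨_, _, D.gen ∘ eα, D.rel ∘ eβ, iβ.hom ≫ f ≫ iα.inv, ⟨i.symm ≪≫ ?_⟩⟩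
  exact cokernel.mapIso _ _ iβ.symm iα.symm (by simp)

end PersistenceModule
end

/-! ### The two implications -/

noncomputable section
namespace PersistenceModule

variable {k : Type u} [Field k] {n : ℕ} {M N : PersistenceModule k n}

theorem FinitelyPresentable.exists_decomp (h : M.FinitelyPresentable) :
    ∃ (J : Type) (_ : Fintype J) (F : J → PersistenceModule k n),
      Nonempty (Decomp M F) ∧ ∀ j, Indecomposable (F j) := by
  obtain ⟨p, q, D, ⟨e⟩⟩ := h.exists_presentation
  exact GeneratedAt.exists_decomp _ M
    (D.generatedAt.of_retract e.hom e.inv e.hom_inv_id) le_rfl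

/-- Every finitely presentable module is arbitrarily close to an indecomposable one. -/
theorem FinitelyPresentable.exists_indecomposable (hn : 2 ≤ n) (h : M.FinitelyPresentable)
    {δ : ℝ≥0} (hδ : 0 < δ) : ∃ N : PersistenceModule k n, N.FinitelyPresentable ∧
      Indecomposable N ∧ Interleaved δ M N := by
  obtain ⟨p, q, D, ⟨e⟩⟩ := h.exists_presentation
  obtain ⟨γ⟩ := Presentation.exists_gluing hn D hδ
  exact ⟨_, γ.pres.finitelyPresentable, γ.indecomposable, γ.interleaved.of_iso e⟩

theorem interleavingDist_le {ε : ℝ≥0} (h : Interleaved ε M N) : interleavingDist M N ≤ ε :=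
  iInf₂_le ε h

theorem exists_interleaved_of_lt {δ : ℝ≥0} (h : interleavingDist M N < δ) :
    ∃ ε < δ, Interleaved ε M N := by
  obtain ⟨ε, hε⟩ := iInf_lt_iff.1 h
  obtain ⟨h1, h2⟩ := iInf_lt_iff.1 hε
  exact ⟨ε, ENNReal.coe_lt_coe.1 h2, h1⟩

theorem bottleneckDist_le {ε : ℝ≥0} (h : Matched ε M N) : bottleneckDist M N ≤ ε :=
  iInf₂_le ε h

theorem exists_matched_of_lt {δ : ℝ≥0} (h : bottleneckDist M N < δ) :
    ∃ ε < δ, Matched ε M N := by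
  obtain ⟨ε, hε⟩ := iInf_lt_iff.1 h
  obtain ⟨h1, h2⟩ := iInf_lt_iff.1 hε
  exact ⟨ε, ENNReal.coe_lt_coe.1 h2, h1⟩

theorem StructurallyStable.indecomposable_or_isZero (hn : 2 ≤ n) (hM : M.FinitelyPresentable)
    (hS : M.StructurallyStable) : Indecomposable M ∨ IsZero M := by
  obtain ⟨p, q, D, ⟨e⟩⟩ := hM.exists_presentation
  obtain ⟨γ, hγ, hD⟩ := D.exists_gap
  -- A matching error below `γ / 2` keeps the shift by twice the error within the gap.
  obtain ⟨δ, hδ, hS⟩ := hS (γ / 2) (half_pos hγ)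
  obtain ⟨N, hN, hN', hMN⟩ := hM.exists_indecomposable hn (half_pos hδ)
  obtain ⟨ε, hε, h⟩ := exists_matched_of_lt (hS N hN
    ((interleavingDist_le hMN).trans_lt (ENNReal.coe_lt_coe.2 (half_lt_self_iff.2 hδ))))
  have hε' : (ε : ℝ) < γ / 2 := by exact_mod_cast hε
  rcases indecomposable_of_matched D (fun r hr => hD r (by linarith)) hN'
    (h.of_iso e.symm) with h | h
  · exact .inl (h.of_iso e.symm)
  · exact .inr (h.of_iso e)

theorem structurallyStable_of_isZero (hM : IsZero M) : M.StructurallyStable := by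
  intro ε hε
  refine ⟨ε, hε, fun N hN h => ?_⟩
  obtain ⟨ε', hε', h'⟩ := exists_interleaved_of_lt h
  obtain ⟨J, _, F, ⟨d⟩, hF⟩ := hN.exists_decomp
  exact (bottleneckDist_le (matched_of_isZero hM h' d hF)).trans_lt (ENNReal.coe_lt_coe.2 hε')

theorem structurallyStable_of_indecomposable (hM : M.FinitelyPresentable)
    (hM' : Indecomposable M) : M.StructurallyStable := by
  obtain ⟨p, q, D, ⟨e⟩⟩ := hM.exists_presentation
  obtain ⟨γ, hγ, hD⟩ := D.exists_gap
  intro ε hε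
  -- `γ / 4` allows the shift by `4 * ε'` used for idempotency, and `ε / 2` absorbs the factor `2`
  -- in the matching.
  refine ⟨min (γ / 4) (ε / 2), lt_min (div_pos hγ (by norm_num)) (half_pos hε),
    fun N hN h => ?_⟩
  obtain ⟨ε', hε', h'⟩ := exists_interleaved_of_lt h
  obtain ⟨h1, h2⟩ := lt_min_iff.1 hε'
  have h3 : (ε' : ℝ) < γ / 4 := by exact_mod_cast h1
  obtain ⟨J, _, F, ⟨d⟩, hF⟩ := hN.exists_decomp
  have h4 := matched_of_interleaved D (hM'.of_iso e) (fun r hr => hD r (by linarith))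
    (h'.of_iso e.symm) d hF
  refine (bottleneckDist_le (h4.of_iso e)).trans_lt (ENNReal.coe_lt_coe.2 ?_)
  rw [mul_comm]
  exact (lt_div_iff₀ (by norm_num)).1 h2

end PersistenceModule
end

theorem mainTheorem4 {k : Type u} [Field k] {n : ℕ} (hn : 2 ≤ n)
    (M : PersistenceModule k n) (hM : M.FinitelyPresentable) :
    M.StructurallyStable ↔ Indecomposable M ∨ IsZero M := by
  refine ⟨fun h => h.indecomposable_or_isZero hn hM, ?_⟩
  rintro (h | h)
  · exact PersistenceModule.structurallyStable_of_indecomposable hM h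
  · exact PersistenceModule.structurallyStable_of_isZero h
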